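/- Let $k$ be a field of characteristic zero and let $G$ be an abelian group, written multiplicatively. A \emph{$G$-suspensive Lie $k$-algebra} is a Lie $k$-algebra $L=\bigoplus_{Q\in G}L_Q$ with $[L_m,L_n]\subseteq L_{mn}$, together with a $k$-linear action of $G$ such that $g\cdot L_n\subseteq L_{gn}$ and the bracket is $kG$-bilinear. Morphisms are the Lie algebra homomorphisms preserving the grading and commuting with the action of $G$. An element $Q$ of a $k$-bialgebra $A$ is \emph{grouplike} if $\Delta(Q)=Q\otimes Q$ and $\epsilon(Q)=1$; an element $a\in A$ is \emph{$Q$-primitive} if $\Delta(a)=a\otimes Q+Q\otimes a$; the \emph{generalized primitives} are the $k$-linear combinations of $Q$-primitives for various grouplikes $Q$. The bialgebra $A$ is \emph{generalized-primitively-generated} if it is generated as a $k$-algebra by its grouplikes and generalized primitives. A \emph{$G$-rigid $k$-bialgebra} is a $k$-bialgebra $A$ together with a homomorphism of $k$-bialgebras $\eta:kG\to A$ with central image which induces a bijection from the grouplikes of $kG$ to the grouplikes of $A$. Morphisms are the bialgebra homomorphisms commuting with the maps $\eta$. For a $G$-rigid $k$-bialgebra $A$, let $GP_*(A)$ be the space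 of generalized primitives of $A$ with the commutator bracket, the grading whose component of degree $Q\in G$ is the space of $\eta(Q)$-primitives, and the action of $g\in G$ by multiplication by $\eta(g)$; this is a $G$-suspensive Lie $k$-algebra. For a $G$-suspensive Lie $k$-algebra $L$, let $W(L)$ be the quotient of the $k$-algebra $kG\otimes_k T(L)$ (where $T(L)$ is the tensor algebra) by the two-sided ideal generated by all $1\otimes(xy-yx)-1\otimes[x,y]$ and $g\otimes x-1\otimes(g\cdot x)$ with $x,y\in L$ and $g\in G$; it is a generalized-primitively-generated $G$-rigid $k$-bialgebra with $\Delta(g)=g\otimes g$ and $\epsilon(g)=1$ for $g\in G$, with $\Delta(x)=x\otimes Q+Q\otimes x$ and $\epsilon(x)=0$ for $x\in L_Q$, and with the evident map $kG\to W(L)$. Both constructions are functorial. Then the category of $G$-suspensive Lie $k$-algebras is equivalent to the category of generalized-primitively-generated $G$-rigid $k$-bialgebras, and the functors $W$ and $GP_*$ are equivalences of categories inverse to each other (up to natural isomorphism). -/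

import Mathlib

open CategoryTheory
open scoped TensorProduct

universe u v w

noncomputable section

namespace GRigid

section Primitives

variable (k : Type u) [Field k] {A : Type w} [Ring A] [Bialgebra k A]

/-- The subspace of `Q`-primitive elements: those `a` with `Δ a = a ⊗ Q + Q ⊗ a`. -/
def primitivesAt (Q : A) : Submodule k A where
  carrier := {a | Coalgebra.comul (R := k) a = a ⊗ₜ[k] Q + Q ⊗ₜ[k] a}
  add_mem' := by
    intro a b ha hb
    simp only [Set.mem_ofPred_eq] at ha hb ⊢
    rw [map_add, ha, hb, TensorProduct.add_tmul, TensorProduct.tmul_add]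
    abel
  zero_mem' := by simp
  smul_mem' := by
    intro c a ha
    simp only [Set.mem_ofPred_eq] at ha ⊢
    rw [map_smul, ha, smul_add, TensorProduct.smul_tmul', TensorProduct.tmul_smul]

variable {k} in
theorem mem_primitivesAt {Q a : A} :
    a ∈ primitivesAt k Q ↔ Coalgebra.comul (R := k) a = a ⊗ₜ[k] Q + Q ⊗ₜ[k] a := Iff.rfl

variable (A) in
/-- The generalized primitives: linear combinations of `Q`-primitives, for varying grouplikes `Q`. -/
def genPrimitives : Submodule k A :=
  ⨆ Q : {Q : A // IsGroupLikeElem k Q}, primitivesAt k Q.1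

variable (A) in
/-- A bialgebra is generalized-primitively-generated if every element is a linear combination of
products of grouplikes and generalized primitives, i.e. if these generate it as an algebra. -/
def IsGenPrimGenerated : Prop :=
  Algebra.adjoin k ({a : A | IsGroupLikeElem k a} ∪ (genPrimitives k A : Set A)) = ⊤

end Primitives

section SuspLie

variable (k : Type u) [Field k] (G : Type v) [CommMonoid G]

open Classical in
/-- A `G`-suspensive Lie algebra over `k`: a `G`-graded Lie algebra with a linear action of `G`
which is compatible with the grading and for which the bracket is `kG`-bilinear. -/
structure SuspLie where
  carrier : Type w
  [lieRing : LieRing carrier]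
  [lieAlgebra : LieAlgebra k carrier]
  /-- the homogeneous components -/
  deg : G → Submodule k carrier
  isInternal : DirectSum.IsInternal deg
  lie_mem : ∀ {m n : G} {x y : carrier}, x ∈ deg m → y ∈ deg n → ⁅x, y⁆ ∈ deg (m * n)
  /-- the action of `G` -/
  act : G →* Module.End k carrier
  act_mem : ∀ (g : G) {n : G} {x : carrier}, x ∈ deg n → act g x ∈ deg (g * n)
  act_lie : ∀ (g : G) (x y : carrier), ⁅act g x, y⁆ = act g ⁅x, y⁆
  lie_act : ∀ (g : G) (x y : carrier), ⁅x, act g y⁆ = act g ⁅x, y⁆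

attribute [instance] SuspLie.lieRing SuspLie.lieAlgebra

namespace SuspLie

variable {k G}

/-- Homomorphisms of `G`-suspensive Lie algebras: Lie algebra homomorphisms which preserve the
grading and commute with the action of `G`. -/
@[ext]
structure Hom (L M : SuspLie.{u, v, w} k G) where
  toLieHom : L.carrier →ₗ⁅k⁆ M.carrier
  map_deg : ∀ (g : G) (x : L.carrier), x ∈ L.deg g → toLieHom x ∈ M.deg g
  map_act : ∀ (g : G) (x : L.carrier), toLieHom (L.act g x) = M.act g (toLieHom x)

/-- The category of `G`-suspensive Lie `k`-algebras. -/
instance : Category (SuspLie.{u, v, w} k G) where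
  Hom L M := Hom L M
  id L := ⟨LieHom.id, fun _ _ h => h, fun _ _ => rfl⟩
  comp f f' := ⟨f'.toLieHom.comp f.toLieHom,
    fun g _ h => f'.map_deg g _ (f.map_deg g _ h),
    fun g x => by simp [f.map_act, f'.map_act]⟩

variable (L : SuspLie.{u, v, w} k G)

theorem homog_induction {p : L.carrier → Prop} (hom : ∀ (Q : G) (x), x ∈ L.deg Q → p x)
    (add : ∀ x y, p x → p y → p (x + y)) (x : L.carrier) : p x := by
  classical
  have hx : x ∈ iSup L.deg := by
    have := L.isInternal
    rw [DirectSum.isInternal_submodule_iff_iSupIndep_and_iSup_eq_top] at this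
    rw [this.2]; trivial
  exact Submodule.iSup_induction (motive := p) _ hx hom
    (hom 1 0 (Submodule.zero_mem _)) add

open Classical in
/-- The linear map out of `L` with prescribed restriction to each homogeneous component. -/
def ofComponents {M : Type*} [AddCommGroup M] [Module k M] (f : G → L.carrier →ₗ[k] M) :
    L.carrier →ₗ[k] M :=
  DirectSum.toModule k G M (fun Q => (f Q).comp (L.deg Q).subtype) ∘ₗ
    (LinearEquiv.ofBijective (DirectSum.coeLinearMap L.deg) L.isInternal).symm.toLinearMap

theorem ofComponents_apply {M : Type*} [AddCommGroup M] [Module k M]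
    (f : G → L.carrier →ₗ[k] M) {Q : G} {x : L.carrier} (hx : x ∈ L.deg Q) :
    L.ofComponents f x = f Q x := by
  classical
  have : (LinearEquiv.ofBijective (DirectSum.coeLinearMap L.deg) L.isInternal).symm x =
      DirectSum.lof k G (fun Q => L.deg Q) Q ⟨x, hx⟩ := by
    rw [LinearEquiv.symm_apply_eq]
    exact (DirectSum.coeLinearMap_lof L.deg Q ⟨x, hx⟩).symm
  rw [ofComponents, LinearMap.comp_apply, LinearEquiv.coe_coe, this, DirectSum.toModule_lof]
  rfl

end SuspLie

end SuspLie

section Rigid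

variable (k : Type u) [Field k] (G : Type v) [CommMonoid G]

/-- A `G`-rigid `k`-bialgebra: a bialgebra `A` with a bialgebra homomorphism `η : kG → A` which has
central image and restricts to a bijection from the grouplikes of `kG` to those of `A`. -/
structure RigBialg where
  carrier : Type w
  [ring : Ring carrier]
  [bialgebra : Bialgebra k carrier]
  /-- the rigid unit map -/
  η : MonoidAlgebra k G →ₐc[k] carrier
  bijOn_grouplikes : Set.BijOn η {x | IsGroupLikeElem k x} {a | IsGroupLikeElem k a}
  central : ∀ x, η x ∈ Subalgebra.center k carrier

attribute [instance] RigBialg.ring RigBialg.bialgebra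

namespace RigBialg

variable {k G}

/-- Homomorphisms of `G`-rigid bialgebras: bialgebra homomorphisms which commute with the rigid
unit maps. -/
@[ext]
structure Hom (A B : RigBialg.{u, v, w} k G) where
  toBialgHom : A.carrier →ₐc[k] B.carrier
  comp_η : toBialgHom.comp A.η = B.η

/-- The category of `G`-rigid `k`-bialgebras. -/
instance : Category (RigBialg.{u, v, w} k G) where
  Hom A B := Hom A B
  id A := ⟨BialgHom.id k A.carrier, BialgHom.id_comp _⟩
  comp f g := ⟨g.toBialgHom.comp f.toBialgHom, by
    rw [BialgHom.comp_assoc, f.comp_η, g.comp_η]⟩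

variable (A : RigBialg.{u, v, w} k G)

/-- The grouplike element of `A` corresponding to `g : G`. -/
def gl (g : G) : A.carrier := A.η (MonoidAlgebra.of k G g)

theorem gl_mul (g h : G) : A.gl (g * h) = A.gl g * A.gl h := by
  rw [gl, map_mul, map_mul]; rfl

theorem gl_one : A.gl 1 = 1 := by
  rw [gl, map_one, map_one]

theorem gl_comm (g : G) (a : A.carrier) : A.gl g * a = a * A.gl g :=
  ((Subalgebra.mem_center_iff.1 (A.central _)) a).symm

theorem isGroupLikeElem_gl (g : G) : IsGroupLikeElem k (A.gl g) :=
  (MonoidAlgebra.isGroupLikeElem_of g).map A.η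

theorem exists_gl {a : A.carrier} (ha : IsGroupLikeElem k a) : ∃ g, A.gl g = a := by
  obtain ⟨x, hx, rfl⟩ := A.bijOn_grouplikes.surjOn ha
  obtain ⟨g, rfl⟩ := MonoidAlgebra.isGroupLikeElem_iff_mem_range_of.1 hx
  exact ⟨g, rfl⟩

theorem gl_injective : Function.Injective A.gl := fun _ _ h =>
  MonoidAlgebra.of_injective (A.bijOn_grouplikes.injOn (MonoidAlgebra.isGroupLikeElem_of _)
    (MonoidAlgebra.isGroupLikeElem_of _) h)

theorem linearIndependent_gl : LinearIndependent k A.gl :=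
  linearIndepOn_isGroupLikeElem.linearIndependent.comp
    (fun g => (⟨A.gl g, A.isGroupLikeElem_gl g⟩ : {a : A.carrier | IsGroupLikeElem k a}))
    (fun _ _ h => A.gl_injective (congrArg Subtype.val h))

theorem Hom.map_gl {A B : RigBialg.{u, v, w} k G} (f : Hom A B) (g : G) :
    f.toBialgHom (A.gl g) = B.gl g :=
  DFunLike.congr_fun f.comp_η (MonoidAlgebra.of k G g)

theorem genPrimitives_eq : genPrimitives k A.carrier = ⨆ g, primitivesAt k (A.gl g) := by
  apply le_antisymm
  · refine iSup_le fun Q => ?_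
    obtain ⟨g, hg⟩ := A.exists_gl Q.2
    rw [← hg]
    exact le_iSup (fun g => primitivesAt k (A.gl g)) g
  · refine iSup_le fun g => ?_
    exact le_iSup (fun Q : {Q : A.carrier // IsGroupLikeElem k Q} => primitivesAt k Q.1)
      ⟨_, A.isGroupLikeElem_gl g⟩

theorem primitivesAt_le (g : G) : primitivesAt k (A.gl g) ≤ genPrimitives k A.carrier := by
  rw [genPrimitives_eq]
  exact le_iSup (fun g => primitivesAt k (A.gl g)) g

theorem gl_mul_mem (g : G) {h : G} {a : A.carrier} (ha : a ∈ primitivesAt k (A.gl h)) :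
    A.gl g * a ∈ primitivesAt k (A.gl (g * h)) := by
  rw [mem_primitivesAt] at ha ⊢
  rw [Bialgebra.comul_mul, ha, (A.isGroupLikeElem_gl g).comul_eq_tmul_self, gl_mul, mul_add,
    Algebra.TensorProduct.tmul_mul_tmul, Algebra.TensorProduct.tmul_mul_tmul]

theorem commutator_mem {g h : G} {a b : A.carrier} (ha : a ∈ primitivesAt k (A.gl g))
    (hb : b ∈ primitivesAt k (A.gl h)) : a * b - b * a ∈ primitivesAt k (A.gl (g * h)) := by
  rw [mem_primitivesAt] at ha hb ⊢
  rw [map_sub, Bialgebra.comul_mul, Bialgebra.comul_mul, ha, hb]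
  simp only [mul_add, add_mul, Algebra.TensorProduct.tmul_mul_tmul, TensorProduct.sub_tmul,
    TensorProduct.tmul_sub, gl_mul]
  rw [A.gl_comm g b, A.gl_comm h a, A.gl_comm h (A.gl g)]
  abel

theorem exists_dual_gl (g : G) :
    ∃ f : A.carrier →ₗ[k] k, f (A.gl g) = 1 ∧ ∀ h, h ≠ g → f (A.gl h) = 0 := by
  have hli := A.linearIndependent_gl
  obtain ⟨f, hf⟩ := LinearMap.exists_extend ((Finsupp.lapply g : (G →₀ k) →ₗ[k] k) ∘ₗ
    (hli.repr : Submodule.span k (Set.range A.gl) →ₗ[k] G →₀ k))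
  have key : ∀ h, f (A.gl h) = (Finsupp.single h 1 : G →₀ k) g := by
    intro h
    have := DFunLike.congr_fun hf ⟨A.gl h, Submodule.subset_span ⟨h, rfl⟩⟩
    simp only [LinearMap.comp_apply, Submodule.subtype_apply] at this
    rw [this, hli.repr_eq_single h _ rfl]
    rfl
  exact ⟨f, by rw [key, Finsupp.single_eq_same], fun h hh => by
    rw [key, Finsupp.single_eq_of_ne hh.symm]⟩

/-- The sum of the spaces of `Q`-primitives, over all grouplikes `Q`, is direct. -/
theorem iSupIndep_primitivesAt : iSupIndep fun g => primitivesAt k (A.gl g) := by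
  classical
  refine iSupIndep_of_dfinsupp_lsum_injective _ ?_
  rw [injective_iff_map_eq_zero]
  intro m hm
  refine DFinsupp.ext fun g => Subtype.ext ?_
  obtain ⟨f, hfg, hf⟩ := A.exists_dual_gl g
  let T : A.carrier →ₗ[k] A.carrier :=
    (TensorProduct.rid k A.carrier).toLinearMap ∘ₗ f.lTensor A.carrier ∘ₗ Coalgebra.comul
  have T_prim : ∀ {h : G} {a : A.carrier}, a ∈ primitivesAt k (A.gl h) →
      T a = f (A.gl h) • a + f a • A.gl h := by
    intro h a ha
    rw [mem_primitivesAt] at ha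
    simp [T, ha]
  let S := Submodule.span k (Set.range A.gl)
  have T_span : ∀ a ∈ S, T a = f a • A.gl g := by
    intro a ha
    induction ha using Submodule.span_induction with
    | mem a ha =>
      obtain ⟨h, rfl⟩ := ha
      have : T (A.gl h) = f (A.gl h) • A.gl h := by
        simp [T, (A.isGroupLikeElem_gl h).comul_eq_tmul_self]
      rw [this]
      by_cases hh : h = g
      · rw [hh]
      · rw [hf h hh, zero_smul, zero_smul]
    | zero => simp
    | add a b _ _ ha hb => rw [map_add, map_add, add_smul, ha, hb]
    | smul c a _ ha => rw [map_smul, map_smul, ha, smul_assoc]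
  have T_sum : ∀ m : Π₀ h, primitivesAt k (A.gl h),
      T (DFinsupp.lsum ℕ (fun h => (primitivesAt k (A.gl h)).subtype) m) - (m g : A.carrier)
        ∈ S := by
    intro m
    induction m using DFinsupp.induction with
    | h0 => simp
    | ha h a m _ _ ih =>
      have e : T a - ((DFinsupp.single h a : Π₀ h, primitivesAt k (A.gl h)) g : A.carrier) ∈ S := by
        rw [T_prim a.2]
        have hS : f a • A.gl h ∈ S := S.smul_mem _ (Submodule.subset_span ⟨h, rfl⟩)
        by_cases hh : h = g
        · subst hh
          rw [hfg, DFinsupp.single_eq_same, one_smul, add_sub_cancel_left]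
          exact hS
        · rw [hf h hh, DFinsupp.single_eq_of_ne (Ne.symm hh), zero_smul, zero_add,
            Submodule.coe_zero, sub_zero]
          exact hS
      have := S.add_mem e ih
      rw [map_add, map_add, DFinsupp.lsum_single, DFinsupp.add_apply, Submodule.coe_add,
        add_sub_add_comm]
      exact this
  have hS : (m g : A.carrier) ∈ S := by
    have := T_sum m
    rw [hm, map_zero, zero_sub] at this
    exact (Submodule.neg_mem_iff _).1 this
  have h1 := T_span _ hS
  rw [T_prim (m g).2, hfg, one_smul, add_eq_right] at h1
  simpa using h1

end RigBialg

end Rigid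

section Enveloping

variable {k : Type u} [Field k] {G : Type v} [CommMonoid G] (L : SuspLie.{u, v, w} k G)

open TensorAlgebra in
/-- The relations defining `W(L)` as a quotient of `kG ⊗ T(L)`. -/
inductive WRel : MonoidAlgebra k G ⊗[k] TensorAlgebra k L.carrier →
    MonoidAlgebra k G ⊗[k] TensorAlgebra k L.carrier → Prop
  | bracket (x y : L.carrier) :
      WRel (1 ⊗ₜ (ι k x * ι k y - ι k y * ι k x)) (1 ⊗ₜ ι k ⁅x, y⁆)
  | action (g : G) (x : L.carrier) :
      WRel (MonoidAlgebra.of k G g ⊗ₜ ι k x) (1 ⊗ₜ ι k (L.act g x))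

/-- The algebra `W(L)`: the quotient of `kG ⊗ T(L)` by the two-sided ideal generated by
`1 ⊗ (xy - yx) - 1 ⊗ [x, y]` and `g ⊗ x - 1 ⊗ (g • x)`. -/
def WAlg : Type max u v w := RingQuot (WRel L)

namespace WAlg

instance : Ring (WAlg L) := inferInstanceAs (Ring (RingQuot (WRel L)))
instance : Algebra k (WAlg L) := inferInstanceAs (Algebra k (RingQuot (WRel L)))

/-- The quotient map. -/
def mk : MonoidAlgebra k G ⊗[k] TensorAlgebra k L.carrier →ₐ[k] WAlg L :=
  RingQuot.mkAlgHom k (WRel L)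

/-- The map `kG → W(L)`. -/
def ofGrp : MonoidAlgebra k G →ₐ[k] WAlg L :=
  (mk L).comp Algebra.TensorProduct.includeLeft

/-- The class in `W(L)` of an element of `G`. -/
def gl (g : G) : WAlg L := ofGrp L (MonoidAlgebra.of k G g)

/-- The natural map `L → W(L)`. -/
def ι : L.carrier →ₗ[k] WAlg L :=
  ((mk L).comp Algebra.TensorProduct.includeRight).toLinearMap ∘ₗ TensorAlgebra.ι k

theorem gl_one : gl L 1 = 1 := by rw [gl, map_one, map_one]

theorem gl_mul (g h : G) : gl L (g * h) = gl L g * gl L h := by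
  rw [gl, map_mul, map_mul]; rfl

theorem ι_lie (x y : L.carrier) : ι L ⁅x, y⁆ = ι L x * ι L y - ι L y * ι L x := by
  have := RingQuot.mkAlgHom_rel k (WRel.bracket (L := L) x y)
  have h2 : ∀ t, mk L (1 ⊗ₜ t) = ((mk L).comp Algebra.TensorProduct.includeRight) t :=
    fun _ => rfl
  change mk L _ = mk L _ at this
  rw [h2, h2, map_sub, map_mul, map_mul] at this
  exact this.symm

theorem gl_mul_ι (g : G) (x : L.carrier) : gl L g * ι L x = ι L (L.act g x) := by
  have := RingQuot.mkAlgHom_rel k (WRel.action (L := L) g x)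
  change mk L _ = mk L _ at this
  change mk L (_ ⊗ₜ _) * mk L (_ ⊗ₜ _) = _
  rw [← map_mul, Algebra.TensorProduct.tmul_mul_tmul, mul_one, one_mul, this]
  rfl

theorem ofGrp_comm (x : MonoidAlgebra k G) (a : WAlg L) : ofGrp L x * a = a * ofGrp L x := by
  obtain ⟨a, rfl⟩ := RingQuot.mkAlgHom_surjective k (WRel L) a
  change mk L (x ⊗ₜ 1) * mk L a = mk L a * mk L (x ⊗ₜ 1)
  rw [← map_mul, ← map_mul]
  congr 1
  induction a using TensorProduct.induction_on with
  | zero => simp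
  | tmul y t => simp [mul_comm]
  | add a b ha hb => rw [mul_add, add_mul, ha, hb]

theorem gl_comm (g : G) (a : WAlg L) : gl L g * a = a * gl L g := ofGrp_comm L _ a

variable {L} in
theorem algHom_ext {B : Type*} [Semiring B] [Algebra k B] {f f' : WAlg L →ₐ[k] B}
    (h1 : ∀ g, f (gl L g) = f' (gl L g)) (h2 : ∀ x, f (ι L x) = f' (ι L x)) : f = f' := by
  refine RingQuot.ringQuot_ext' k _ _ ?_
  refine Algebra.TensorProduct.ext ?_ ?_
  · refine MonoidAlgebra.algHom_ext (fun g => ?_) (Subsingleton.elim _ _)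
    exact h1 g
  · exact TensorAlgebra.hom_ext (LinearMap.ext h2)

variable {L} in
theorem algHom_ext_homog {B : Type*} [Semiring B] [Algebra k B] {f f' : WAlg L →ₐ[k] B}
    (h1 : ∀ g, f (gl L g) = f' (gl L g))
    (h2 : ∀ Q, ∀ x ∈ L.deg Q, f (ι L x) = f' (ι L x)) : f = f' := by
  refine algHom_ext h1 fun x => ?_
  refine L.homog_induction (p := fun x => f (ι L x) = f' (ι L x)) h2 (fun x y hx hy => ?_) x
  rw [map_add, map_add, map_add, hx, hy]

section lift

variable {L} {B : Type*} [Ring B] [Algebra k B] (φ : G →* B) (f : L.carrier →ₗ[k] B)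
  (hc : ∀ g x, φ g * f x = f x * φ g) (hl : ∀ x y, f ⁅x, y⁆ = f x * f y - f y * f x)
  (ha : ∀ g x, φ g * f x = f (L.act g x))

/-- The universal property of `W(L)` as an algebra. -/
def lift : WAlg L →ₐ[k] B :=
  RingQuot.liftAlgHom k ⟨Algebra.TensorProduct.lift (MonoidAlgebra.lift k B G φ)
    (TensorAlgebra.lift k f) (by
      intro x t
      induction x using MonoidAlgebra.induction_linear with
      | zero => simp
      | add x y hx hy => rw [map_add]; exact hx.add_left hy
      | single g r =>
        rw [MonoidAlgebra.lift_single]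
        refine Commute.smul_left ?_ r
        induction t using TensorAlgebra.induction with
        | algebraMap r => rw [AlgHom.commutes]; exact (Algebra.commutes r _).symm
        | ι x => rw [TensorAlgebra.lift_ι_apply]; exact hc g x
        | mul a b ha hb => rw [map_mul]; exact ha.mul_right hb
        | add a b ha hb => rw [map_add]; exact ha.add_right hb), by
      intro x y h
      cases h with
      | bracket x y => simp [hl]
      | action g x => simp [ha]⟩

theorem lift_gl (g : G) : lift φ f hc hl ha (gl L g) = φ g := by
  refine (RingQuot.liftAlgHom_mkAlgHom_apply ..).trans ?_
  simp

theorem lift_ι (x : L.carrier) : lift φ f hc hl ha (ι L x) = f x := by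
  refine (RingQuot.liftAlgHom_mkAlgHom_apply ..).trans ?_
  simp

end lift


/-- The coproduct of `W(L)`: `Δ g = g ⊗ g` for `g : G`, and `Δ x = x ⊗ Q + Q ⊗ x` for `x` in the
component of `L` of degree `Q`. -/
def comulLin : L.carrier →ₗ[k] WAlg L ⊗[k] WAlg L :=
  L.ofComponents fun Q =>
    (TensorProduct.mk k (WAlg L) (WAlg L)).flip (gl L Q) ∘ₗ ι L +
      TensorProduct.mk k (WAlg L) (WAlg L) (gl L Q) ∘ₗ ι L

theorem comulLin_apply {Q : G} {x : L.carrier} (hx : x ∈ L.deg Q) :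
    comulLin L x = ι L x ⊗ₜ gl L Q + gl L Q ⊗ₜ ι L x := by
  rw [comulLin, L.ofComponents_apply _ hx]; rfl

/-- The map `g ↦ g ⊗ g`. -/
def comulGrp : G →* WAlg L ⊗[k] WAlg L where
  toFun g := gl L g ⊗ₜ gl L g
  map_one' := by rw [gl_one]; rfl
  map_mul' g h := by rw [gl_mul, Algebra.TensorProduct.tmul_mul_tmul]

theorem comulGrp_apply (g : G) : comulGrp L g = gl L g ⊗ₜ gl L g := rfl

/-- The coproduct of `W(L)`. -/
def comul : WAlg L →ₐ[k] WAlg L ⊗[k] WAlg L :=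
  lift (comulGrp L) (comulLin L)
    (fun g x => L.homog_induction (p := fun x => comulGrp L g * comulLin L x =
        comulLin L x * comulGrp L g)
      (fun Q x hx => by
        simp only [comulLin_apply L hx, comulGrp_apply, mul_add, add_mul,
          Algebra.TensorProduct.tmul_mul_tmul, gl_comm L g])
      (fun x y hx hy => by rw [map_add, mul_add, add_mul, hx, hy]) x)
    (fun x y => L.homog_induction (p := fun x => comulLin L ⁅x, y⁆ =
        comulLin L x * comulLin L y - comulLin L y * comulLin L x)
      (fun Q x hx => L.homog_induction (p := fun y => comulLin L ⁅x, y⁆ =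
          comulLin L x * comulLin L y - comulLin L y * comulLin L x)
        (fun R y hy => by
          simp only [comulLin_apply L hx, comulLin_apply L hy, comulLin_apply L (L.lie_mem hx hy),
            mul_add, add_mul, Algebra.TensorProduct.tmul_mul_tmul, ι_lie, gl_mul,
            TensorProduct.sub_tmul, TensorProduct.tmul_sub]
          rw [gl_comm L R (ι L x), gl_comm L Q (ι L y), gl_comm L R (gl L Q)]
          abel)
        (fun y z hy hz => by
          rw [lie_add, map_add, map_add, hy, hz, mul_add, add_mul]; abel) y)
      (fun x z hx hz => by
        rw [add_lie, map_add, map_add, hx, hz, mul_add, add_mul]; abel) x)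
    (fun g x => L.homog_induction (p := fun x => comulGrp L g * comulLin L x =
        comulLin L (L.act g x))
      (fun Q x hx => by
        simp only [comulLin_apply L hx, comulLin_apply L (L.act_mem g hx), comulGrp_apply, mul_add,
          Algebra.TensorProduct.tmul_mul_tmul, gl_mul_ι, gl_mul])
      (fun x y hx hy => by rw [map_add, mul_add, map_add, map_add, hx, hy]) x)

theorem comul_gl (g : G) : comul L (gl L g) = gl L g ⊗ₜ gl L g := lift_gl ..

theorem comul_ι {Q : G} {x : L.carrier} (hx : x ∈ L.deg Q) :
    comul L (ι L x) = ι L x ⊗ₜ gl L Q + gl L Q ⊗ₜ ι L x :=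
  (lift_ι ..).trans (comulLin_apply L hx)

/-- The augmentation of `W(L)`: `ε g = 1` for `g : G`, and `ε x = 0` for `x : L`. -/
def counit : WAlg L →ₐ[k] k :=
  lift (1 : G →* k) (0 : L.carrier →ₗ[k] k) (by simp) (by simp) (by simp)

theorem counit_gl (g : G) : counit L (gl L g) = 1 := lift_gl ..

theorem counit_ι (x : L.carrier) : counit L (ι L x) = 0 := lift_ι ..

/-- The bialgebra structure on `W(L)`. -/
instance : Bialgebra k (WAlg L) :=
  Bialgebra.ofAlgHom (comul L) (counit L)
    (algHom_ext_homog
      (fun g => by simp [comul_gl])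
      (fun Q x hx => by
        simp [comul_gl, comul_ι L hx, TensorProduct.add_tmul, TensorProduct.tmul_add, add_assoc]))
    (algHom_ext_homog
      (fun g => by simp [comul_gl, counit_gl])
      (fun Q x hx => by simp [comul_ι L hx, counit_gl, counit_ι]))
    (algHom_ext_homog
      (fun g => by simp [comul_gl, counit_gl])
      (fun Q x hx => by simp [comul_ι L hx, counit_gl, counit_ι]))

theorem isGroupLikeElem_gl (g : G) : IsGroupLikeElem k (gl L g) :=
  ⟨counit_gl L g, comul_gl L g⟩

theorem ι_mem_primitivesAt {Q : G} {x : L.carrier} (hx : x ∈ L.deg Q) :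
    ι L x ∈ primitivesAt k (gl L Q) := comul_ι L hx

/-- The rigid unit map of `W(L)`. -/
def η : MonoidAlgebra k G →ₐc[k] WAlg L :=
  BialgHom.ofAlgHom (ofGrp L)
    (MonoidAlgebra.algHom_ext (fun g => by
      refine (counit_gl L g).trans ?_
      simp) (Subsingleton.elim _ _))
    (MonoidAlgebra.algHom_ext (fun g => by
      refine Eq.trans ?_ (comul_gl L g).symm
      simp [gl]) (Subsingleton.elim _ _))

theorem η_of (g : G) : η L (MonoidAlgebra.of k G g) = gl L g := rfl

/-- The grouplike generators and the homogeneous Lie generators of `W(L)`. -/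
def gens : Set (WAlg L) := Set.range (gl L) ∪ {a | ∃ Q, ∃ x ∈ L.deg Q, ι L x = a}

theorem adjoin_gens : Algebra.adjoin k (gens L) = ⊤ := by
  rw [eq_top_iff]
  rintro a -
  obtain ⟨a, rfl⟩ := RingQuot.mkAlgHom_surjective k (WRel L) a
  change mk L a ∈ _
  induction a using TensorProduct.induction_on with
  | zero => rw [map_zero]; exact Subalgebra.zero_mem _
  | add a b ha hb => rw [map_add]; exact Subalgebra.add_mem _ ha hb
  | tmul x t =>
    have e : (x ⊗ₜ t : MonoidAlgebra k G ⊗[k] TensorAlgebra k L.carrier) =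
      (x ⊗ₜ 1) * (1 ⊗ₜ t) := by simp
    rw [e, map_mul]
    clear e
    refine Subalgebra.mul_mem _ ?_ ?_
    · change ofGrp L x ∈ _
      induction x using MonoidAlgebra.induction_linear with
      | zero => rw [map_zero]; exact Subalgebra.zero_mem _
      | add a b ha hb => rw [map_add]; exact Subalgebra.add_mem _ ha hb
      | single g r =>
        have : MonoidAlgebra.single g r = r • MonoidAlgebra.of k G g := by simp
        rw [this, map_smul]
        have hg : gl L g ∈ Algebra.adjoin k (gens L) := Algebra.subset_adjoin (Or.inl ⟨g, rfl⟩)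
        exact Subalgebra.smul_mem _ hg r
    · change ((mk L).comp Algebra.TensorProduct.includeRight) t ∈ _
      induction t using TensorAlgebra.induction with
      | algebraMap r => rw [AlgHom.commutes]; exact Subalgebra.algebraMap_mem _ r
      | mul a b ha hb => rw [map_mul]; exact Subalgebra.mul_mem _ ha hb
      | add a b ha hb => rw [map_add]; exact Subalgebra.add_mem _ ha hb
      | ι x =>
        change ι L x ∈ _
        refine L.homog_induction (p := fun x => ι L x ∈ Algebra.adjoin k (gens L))
          (fun Q x hx => ?_) (fun x y hx hy => ?_) x
        · exact Algebra.subset_adjoin (Or.inr ⟨Q, x, hx, rfl⟩)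
        · rw [map_add]; exact Subalgebra.add_mem _ hx hy

theorem isGenPrimGenerated : IsGenPrimGenerated k (WAlg L) := by
  rw [IsGenPrimGenerated, eq_top_iff, ← adjoin_gens L]
  refine Algebra.adjoin_mono ?_
  rintro a (⟨g, rfl⟩ | ⟨Q, x, hx, rfl⟩)
  · exact Or.inl (isGroupLikeElem_gl L g)
  · refine Or.inr ?_
    exact (le_iSup (fun Q : {Q : WAlg L // IsGroupLikeElem k Q} => primitivesAt k Q.1)
      ⟨_, isGroupLikeElem_gl L Q⟩) (ι_mem_primitivesAt L hx)

/-- The filtration of `W(L)` by the number of Lie generators in a product. -/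
def fil : ℕ → Submodule k (WAlg L)
  | 0 => Submodule.span k (Set.range (gl L))
  | n + 1 => Submodule.span k (gens L) * fil n

theorem gens_mul_mem {n : ℕ} {a b : WAlg L} (ha : a ∈ gens L) (hb : b ∈ fil L n) :
    a * b ∈ fil L (n + 1) :=
  Submodule.mul_mem_mul (Submodule.subset_span ha) hb

theorem gl_mem_gens (g : G) : gl L g ∈ gens L := Or.inl ⟨g, rfl⟩

theorem fil_mono : Monotone (fil L) := by
  refine monotone_nat_of_le_succ fun n a ha => ?_
  rw [← one_mul a, ← gl_one L]
  exact gens_mul_mem L (gl_mem_gens L 1) ha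

theorem exists_mem_fil (a : WAlg L) : ∃ n, a ∈ fil L n := by
  have ha : a ∈ Algebra.adjoin k (gens L) := by rw [adjoin_gens]; trivial
  rw [← Subalgebra.mem_toSubmodule, Algebra.adjoin_eq_span] at ha
  induction ha using Submodule.span_induction with
  | mem a ha =>
    induction ha using Submonoid.closure_induction_left with
    | one => exact ⟨0, Submodule.subset_span ⟨1, gl_one L⟩⟩
    | mul_left x hx y _ ih =>
      obtain ⟨n, hn⟩ := ih
      exact ⟨n + 1, gens_mul_mem L hx hn⟩
  | zero => exact ⟨0, Submodule.zero_mem _⟩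
  | add a b _ _ ha hb =>
    obtain ⟨n, hn⟩ := ha
    obtain ⟨m, hm⟩ := hb
    exact ⟨max n m, Submodule.add_mem _ (fil_mono L (le_max_left n m) hn)
      (fil_mono L (le_max_right n m) hm)⟩
  | smul c a _ ha =>
    obtain ⟨n, hn⟩ := ha
    exact ⟨n, Submodule.smul_mem _ c hn⟩

theorem fil_comul (n : ℕ) : ∀ (f f' : WAlg L →ₗ[k] k), (∀ a ∈ fil L n, f a = 0) →
    (∀ a ∈ fil L n, f' a = 0) → ∀ a ∈ fil L (n + 1),
    TensorProduct.map f f' (comul L a) = 0 := by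
  have map_mul_left : ∀ (f f' : WAlg L →ₗ[k] k) (a b : WAlg L) (t : WAlg L ⊗[k] WAlg L),
      TensorProduct.map f f' ((a ⊗ₜ b) * t) =
        TensorProduct.map (f ∘ₗ LinearMap.mulLeft k a) (f' ∘ₗ LinearMap.mulLeft k b) t := by
    intro f f' a b t
    induction t using TensorProduct.induction_on with
    | zero => simp
    | tmul x y => simp
    | add x y hx hy => rw [mul_add, map_add, map_add, hx, hy]
  have red : ∀ (n : ℕ) (f f' : WAlg L →ₗ[k] k), (∀ a ∈ gens L, ∀ b ∈ fil L n,
      TensorProduct.map f f' (comul L (a * b)) = 0) → ∀ a ∈ fil L (n + 1),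
      TensorProduct.map f f' (comul L a) = 0 := by
    intro n f f' h a ha
    induction ha using Submodule.mul_induction_on' with
    | mem_mul_mem a ha b hb =>
      induction ha using Submodule.span_induction with
      | mem a ha => exact h a ha b hb
      | zero => simp
      | add x y _ _ hx hy => rw [add_mul, map_add, map_add, hx, hy, add_zero]
      | smul c x _ hx => rw [smul_mul_assoc, map_smul, map_smul, hx, smul_zero]
    | add a _ b _ ha hb => rw [map_add, map_add, ha, hb, add_zero]
  induction n with
  | zero =>
    intro f f' hf hf'
    have hg : ∀ g h, f (gl L g * gl L h) = 0 := fun g h =>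
      hf _ (Submodule.subset_span ⟨g * h, gl_mul L g h⟩)
    have hg' : ∀ g h, f' (gl L g * gl L h) = 0 := fun g h =>
      hf' _ (Submodule.subset_span ⟨g * h, gl_mul L g h⟩)
    refine red _ f f' fun a ha b hb => ?_
    induction hb using Submodule.span_induction with
    | mem b hb =>
      obtain ⟨h, rfl⟩ := hb
      rcases ha with ⟨g, rfl⟩ | ⟨Q, x, hx, rfl⟩
      · simp [comul_gl, hg]
      · simp [comul_gl, comul_ι L hx, add_mul, hg, hg']
    | zero => simp
    | add x y _ _ hx hy => rw [mul_add, map_add, map_add, hx, hy, add_zero]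
    | smul c x _ hx => rw [mul_smul_comm, map_smul, map_smul, hx, smul_zero]
  | succ n ih =>
    intro f f' hf hf'
    refine red _ f f' fun a ha b hb => ?_
    have key : ∀ x ∈ gens L, ∀ y ∈ gens L,
        TensorProduct.map f f' ((x ⊗ₜ y) * comul L b) = 0 := by
      intro x hx y hy
      rw [map_mul_left]
      exact ih (f ∘ₗ LinearMap.mulLeft k x) (f' ∘ₗ LinearMap.mulLeft k y) (fun a ha => hf _ (gens_mul_mem L hx ha))
        (fun a ha => hf' _ (gens_mul_mem L hy ha)) b hb
    rw [map_mul]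
    rcases ha with ⟨g, rfl⟩ | ⟨Q, x, hx, rfl⟩
    · rw [comul_gl]
      exact key _ (gl_mem_gens L g) _ (gl_mem_gens L g)
    · rw [comul_ι L hx, add_mul, map_add, key _ (Or.inr ⟨Q, x, hx, rfl⟩) _ (gl_mem_gens L Q),
        key _ (gl_mem_gens L Q) _ (Or.inr ⟨Q, x, hx, rfl⟩), add_zero]

/-- The grouplikes of `W(L)` are the elements of `G`. -/
theorem exists_gl {a : WAlg L} (ha : IsGroupLikeElem k a) : ∃ g, gl L g = a := by
  classical
  have h0 : a ∈ fil L 0 := by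
    have hex := exists_mem_fil L a
    obtain ⟨m, hm⟩ | h := (Nat.find hex).eq_zero_or_eq_succ_pred.symm.imp_left
      (fun h => (⟨_, h⟩ : ∃ m, Nat.find hex = m + 1))
    · exfalso
      have h1 : a ∉ fil L m := Nat.find_min hex (by omega)
      have h2 : a ∈ fil L (m + 1) := hm ▸ Nat.find_spec hex
      obtain ⟨f, hf, hfm⟩ := Submodule.exists_le_ker_of_notMem h1
      have := fil_comul L m f f (fun a ha => hfm ha) (fun a ha => hfm ha) a h2
      have hc : comul L a = a ⊗ₜ a := ha.comul_eq_tmul_self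
      rw [hc, TensorProduct.map_tmul] at this
      have h3 := congrArg (TensorProduct.lid k k) this
      rw [TensorProduct.lid_tmul, map_zero, smul_eq_mul, mul_self_eq_zero] at h3
      exact hf h3
    · exact h ▸ Nat.find_spec hex
  by_contra hne
  have hli : LinearIndepOn k id (insert a (Set.range (gl L))) :=
    linearIndepOn_isGroupLikeElem.mono (by
      rintro b (rfl | ⟨g, rfl⟩)
      · exact ha
      · exact isGroupLikeElem_gl L g)
  have := hli.notMem_span_of_insert (by rintro ⟨g, hg⟩; exact hne ⟨g, hg⟩)
  rw [Set.image_id] at this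
  exact this h0

/-- The retraction `W(L) → kG` which kills `L`. -/
def retract : WAlg L →ₐ[k] MonoidAlgebra k G :=
  lift (MonoidAlgebra.of k G) (0 : L.carrier →ₗ[k] MonoidAlgebra k G) (by simp) (by simp) (by simp)

theorem retract_gl (g : G) : retract L (gl L g) = MonoidAlgebra.of k G g := lift_gl ..

theorem gl_injective : Function.Injective (gl L) := fun g h e =>
  MonoidAlgebra.of_injective (R := k) (by rw [← retract_gl L g, e, retract_gl])

/-- `W(L)` as a `G`-rigid bialgebra. -/
def rig : RigBialg.{u, v, max u v w} k G where
  carrier := WAlg L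
  η := η L
  bijOn_grouplikes := by
    refine ⟨fun x hx => IsGroupLikeElem.map (η L) hx, fun x hx y hy e => ?_, fun a ha => ?_⟩
    · obtain ⟨g, rfl⟩ := MonoidAlgebra.isGroupLikeElem_iff_mem_range_of.1 hx
      obtain ⟨h, rfl⟩ := MonoidAlgebra.isGroupLikeElem_iff_mem_range_of.1 hy
      rw [gl_injective L (show gl L g = gl L h from e)]
    · obtain ⟨g, rfl⟩ := exists_gl L ha
      exact ⟨_, MonoidAlgebra.isGroupLikeElem_of g, rfl⟩
  central x := Subalgebra.mem_center_iff.2 fun a => (ofGrp_comm L x a).symm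

variable {L} in
/-- The homomorphism `W(L) → W(M)` induced by a homomorphism `f : L → M`. -/
def map {M : SuspLie.{u, v, w} k G} (f : SuspLie.Hom L M) : WAlg L →ₐ[k] WAlg M :=
  lift ((ofGrp M : MonoidAlgebra k G →* WAlg M).comp (MonoidAlgebra.of k G))
    (ι M ∘ₗ (f.toLieHom : L.carrier →ₗ[k] M.carrier))
    (fun g _ => gl_comm M g _)
    (fun x y => by simp [ι_lie])
    (fun g x => (gl_mul_ι M g (f.toLieHom x)).trans (by simp [f.map_act]))

theorem map_gl {M : SuspLie.{u, v, w} k G} (f : SuspLie.Hom L M) (g : G) :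
    map f (gl L g) = gl M g := lift_gl ..

theorem map_ι {M : SuspLie.{u, v, w} k G} (f : SuspLie.Hom L M) (x : L.carrier) :
    map f (ι L x) = ι M (f.toLieHom x) := lift_ι ..

variable {L} in
/-- The homomorphism `W(L) → W(M)` of `G`-rigid bialgebras induced by `f : L → M`. -/
def rigMap {M : SuspLie.{u, v, w} k G} (f : SuspLie.Hom L M) : RigBialg.Hom (rig L) (rig M) where
  toBialgHom := BialgHom.ofAlgHom (A := WAlg L) (B := WAlg M) (map f)
    (algHom_ext
      (fun g => (congrArg (counit M) (map_gl L f g)).trans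
        ((counit_gl M g).trans (counit_gl L g).symm))
      (fun x => (congrArg (counit M) (map_ι L f x)).trans
        ((counit_ι M _).trans (counit_ι L x).symm)))
    (algHom_ext_homog
      (fun g => by
        change Algebra.TensorProduct.map (map f) (map f) (comul L (gl L g)) =
          comul M (map f (gl L g))
        simp [comul_gl, map_gl])
      (fun Q x hx => by
        change Algebra.TensorProduct.map (map f) (map f) (comul L (ι L x)) =
          comul M (map f (ι L x))
        simp [comul_ι L hx, map_gl, map_ι, comul_ι M (f.map_deg Q x hx)]))
  comp_η := BialgHom.coe_toAlgHom_injective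
    (MonoidAlgebra.algHom_ext (fun g => map_gl L f g) (Subsingleton.elim _ _))

end WAlg

end Enveloping

section GP

attribute [local instance 100] LieRing.ofAssociativeRing

variable {k : Type u} [Field k] {G : Type v} [CommMonoid G] (A : RigBialg.{u, v, w} k G)

/-- The Lie subalgebra of generalized primitives, under the commutator bracket. -/
def gpLie : LieSubalgebra k A.carrier where
  toSubmodule := genPrimitives k A.carrier
  lie_mem' := by
    intro x y hx hy
    change x * y - y * x ∈ genPrimitives k A.carrier
    change x ∈ genPrimitives k A.carrier at hx
    change y ∈ genPrimitives k A.carrier at hy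
    rw [A.genPrimitives_eq] at hx hy
    refine Submodule.iSup_induction (motive := fun x => x * y - y * x ∈ genPrimitives k A.carrier)
      _ hx (fun g a ha => ?_) (by simp) (fun a b ha hb => ?_)
    · refine Submodule.iSup_induction
        (motive := fun y => a * y - y * a ∈ genPrimitives k A.carrier)
        _ hy (fun h b hb => ?_) (by simp) (fun b c hb hc => ?_)
      · exact A.primitivesAt_le _ (A.commutator_mem ha hb)
      · rw [mul_add, add_mul, add_sub_add_comm]
        exact Submodule.add_mem _ hb hc
    · rw [mul_add, add_mul, add_sub_add_comm]
      exact Submodule.add_mem _ ha hb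

theorem gl_mul_mem_gen (g : G) {a : A.carrier} (ha : a ∈ genPrimitives k A.carrier) :
    A.gl g * a ∈ genPrimitives k A.carrier := by
  rw [A.genPrimitives_eq] at ha
  refine Submodule.iSup_induction (motive := fun a => A.gl g * a ∈ genPrimitives k A.carrier)
    _ ha (fun h a ha => ?_) (by simp) (fun a b ha hb => ?_)
  · exact A.primitivesAt_le _ (A.gl_mul_mem g ha)
  · rw [mul_add]
    exact Submodule.add_mem _ ha hb

/-- Multiplication by (the grouplike corresponding to) `g : G` on the generalized primitives. -/
def gpAct : G →* Module.End k (gpLie A) where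
  toFun g := (LinearMap.mulLeft k (A.gl g)).restrict
    (p := genPrimitives k A.carrier) (q := genPrimitives k A.carrier)
    (fun _ ha => gl_mul_mem_gen A g ha)
  map_one' := LinearMap.ext fun x => Subtype.ext (by
    change A.gl 1 * (x : A.carrier) = x
    rw [A.gl_one, one_mul])
  map_mul' g h := LinearMap.ext fun x => Subtype.ext (by
    change A.gl (g * h) * (x : A.carrier) = A.gl g * (A.gl h * x)
    rw [A.gl_mul, mul_assoc])

theorem gpAct_coe (g : G) (x : gpLie A) : (gpAct A g x : A.carrier) = A.gl g * x := rfl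

open Classical in
theorem isInternal_gp : DirectSum.IsInternal fun g =>
    (primitivesAt k (A.gl g)).comap (genPrimitives k A.carrier).subtype := by
  have hp : ∀ g, primitivesAt k (A.gl g) ≤ genPrimitives k A.carrier := A.primitivesAt_le
  have hmap : ∀ g, ((primitivesAt k (A.gl g)).comap (genPrimitives k A.carrier).subtype).map
      (genPrimitives k A.carrier).subtype = primitivesAt k (A.gl g) := fun g => by
    rw [Submodule.map_comap_subtype, inf_of_le_right (hp g)]
  refine (DirectSum.isInternal_submodule_iff_iSupIndep_and_iSup_eq_top _).mpr ⟨?_, ?_⟩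
  · let e : Submodule k (genPrimitives k A.carrier) ≃o Set.Iic (genPrimitives k A.carrier) :=
      (genPrimitives k A.carrier).mapIic
    suffices (e ∘ fun g => (primitivesAt k (A.gl g)).comap (genPrimitives k A.carrier).subtype) =
        fun g => ⟨primitivesAt k (A.gl g), hp g⟩ by
      rw [← iSupIndep_map_orderIso_iff e, this]
      exact .of_coe_Iic_comp A.iSupIndep_primitivesAt
    funext g
    exact Subtype.ext (hmap g)
  · apply Submodule.map_injective_of_injective (genPrimitives k A.carrier).injective_subtype
    rw [Submodule.map_iSup, Submodule.map_top, Submodule.range_subtype]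
    simp only [hmap]
    exact A.genPrimitives_eq.symm

/-- The `G`-suspensive Lie algebra `GP_*(A)` of generalized primitives of a `G`-rigid bialgebra. -/
def gp : SuspLie.{u, v, w} k G where
  carrier := gpLie A
  deg g := (primitivesAt k (A.gl g)).comap (genPrimitives k A.carrier).subtype
  isInternal := by
    classical
    exact isInternal_gp A
  lie_mem hx hy := A.commutator_mem hx hy
  act := gpAct A
  act_mem g _ _ hx := A.gl_mul_mem g hx
  act_lie g x y := Subtype.ext (by
    change A.gl g * x * y - y * (A.gl g * x) = A.gl g * (x * y - y * x : A.carrier)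
    rw [mul_sub, ← mul_assoc, ← mul_assoc, ← mul_assoc, A.gl_comm g (y : A.carrier)])
  lie_act g x y := Subtype.ext (by
    change x * (A.gl g * y) - A.gl g * y * x = A.gl g * (x * y - y * x : A.carrier)
    rw [mul_sub, ← mul_assoc, ← mul_assoc, ← mul_assoc, A.gl_comm g (x : A.carrier)])

variable {A}

theorem map_mem_primitivesAt {B : RigBialg.{u, v, w} k G} (f : RigBialg.Hom A B) {g : G}
    {a : A.carrier} (ha : a ∈ primitivesAt k (A.gl g)) :
    f.toBialgHom a ∈ primitivesAt k (B.gl g) := by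
  rw [mem_primitivesAt] at ha ⊢
  rw [← CoalgHomClass.map_comp_comul_apply, ha]
  simp [f.map_gl]

theorem map_mem_genPrimitives {B : RigBialg.{u, v, w} k G} (f : RigBialg.Hom A B)
    {a : A.carrier} (ha : a ∈ genPrimitives k A.carrier) :
    f.toBialgHom a ∈ genPrimitives k B.carrier := by
  rw [A.genPrimitives_eq] at ha
  refine Submodule.iSup_induction (motive := fun a => f.toBialgHom a ∈ genPrimitives k B.carrier)
    _ ha (fun h a ha => ?_) (by simp) (fun a b ha hb => ?_)
  · exact B.primitivesAt_le _ (map_mem_primitivesAt f ha)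
  · rw [map_add]
    exact Submodule.add_mem _ ha hb

/-- The restriction of a homomorphism of `G`-rigid bialgebras to the generalized primitives. -/
def gpMap {B : RigBialg.{u, v, w} k G} (f : RigBialg.Hom A B) : SuspLie.Hom (gp A) (gp B) where
  toLieHom :=
    { toLinearMap := (f.toBialgHom : A.carrier →ₗ[k] B.carrier).restrict
        (p := genPrimitives k A.carrier) (q := genPrimitives k B.carrier)
        (fun _ ha => map_mem_genPrimitives f ha)
      map_lie' := by
        intro x y
        refine Subtype.ext ?_
        change f.toBialgHom (x.1 * y.1 - y.1 * x.1) =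
          f.toBialgHom x.1 * f.toBialgHom y.1 - f.toBialgHom y.1 * f.toBialgHom x.1
        rw [map_sub, map_mul, map_mul] }
  map_deg _ _ hx := map_mem_primitivesAt f hx
  map_act g x := Subtype.ext (by
    change f.toBialgHom (A.gl g * x.1) = B.gl g * f.toBialgHom x.1
    rw [map_mul, f.map_gl])

end GP

section Functors

variable (k : Type u) [Field k] (G : Type v) [CommMonoid G]

/-- The property of being generalized-primitively-generated. Such bialgebras are automatically
cocommutative, as the coproduct is symmetric on grouplikes and on generalized primitives. -/
def isGPG : ObjectProperty (RigBialg.{u, v, w} k G) :=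
  fun A => IsGenPrimGenerated k A.carrier

/-- The category of generalized-primitively-generated `G`-rigid `k`-bialgebras, a full subcategory
of the category of `G`-rigid `k`-bialgebras. -/
abbrev GPGRigBialg := (isGPG.{u, v, w} k G).FullSubcategory

/-- The functor sending a generalized-primitively-generated `G`-rigid `k`-bialgebra to its
`G`-suspensive Lie algebra of generalized primitives. -/
def GP : GPGRigBialg.{u, v, w} k G ⥤ SuspLie.{u, v, w} k G where
  obj A := gp A.obj
  map f := gpMap f.hom

/-- The functor sending a `G`-suspensive Lie algebra to its universal `G`-rigid enveloping
bialgebra. -/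
def W : SuspLie.{u, v, max u v w} k G ⥤ GPGRigBialg.{u, v, max u v w} k G where
  obj L := ⟨WAlg.rig L, WAlg.isGenPrimGenerated L⟩
  map f := ObjectProperty.homMk (WAlg.rigMap f)
  map_id L := by
    apply ObjectProperty.hom_ext
    apply RigBialg.Hom.ext
    apply BialgHom.coe_toAlgHom_injective
    exact WAlg.algHom_ext (fun g => WAlg.map_gl L (SuspLie.Hom.mk _ _ _) g)
      (fun x => WAlg.map_ι L (SuspLie.Hom.mk _ _ _) x)
  map_comp {L M N} f g := by
    apply ObjectProperty.hom_ext
    apply RigBialg.Hom.ext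
    apply BialgHom.coe_toAlgHom_injective
    refine WAlg.algHom_ext (fun h => (WAlg.map_gl L (f ≫ g) h).trans ?_)
      (fun x => (WAlg.map_ι L (f ≫ g) x).trans ?_)
    · exact ((congrArg (WAlg.map g) (WAlg.map_gl L f h)).trans (WAlg.map_gl M g h)).symm
    · exact ((congrArg (WAlg.map g) (WAlg.map_ι L f x)).trans (WAlg.map_ι M g _)).symm

end Functors

end GRigid
end

/-! The two functors are compared through the unit `L → GP_*(W(L))` and the counit `W(GP_*(A)) → A`;
everything reduces to their bijectivity (`unitHom_bijective`, `counitHom_bijective`).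

Since `G` is a group, an element `x` of degree `Q` equals `Q` times the degree-one element `Q⁻¹ x`,
whose image in `W(L)` is an ordinary primitive. In characteristic zero the powers of elements of a
commutator-closed subspace span a space stable under multiplication by that subspace
(`mul_mem_span_pow`), so the products `g a ^ n`, with `g` in `G` and `a` of degree one, span `W(L)`
(`iSup_powSpan`). The operator `double`, a twisted convolution square of the identity, multiplies `g
a ^ n` by `2 ^ n` and any `Q`-primitive by `2`. Eigenspaces for distinct eigenvalues are
independent, so every `Q`-primitive lies in the image of `L` (`exists_ι_of_primitive`).

Injectivity of `L → W(L)` needs an embedding of `L` into some associative algebra `B`; twisting it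
by the grading maps `W(L)` to the group algebra `B[G]`. The embedding takes the place of the
Poincaré–Birkhoff–Witt theorem. The polynomials over `L` without constant term have an affine
representation, built from the adjoint action and the Euler derivation, which is faithful
(`ι_pos_injective`). Evaluation at `1` maps them onto `L`, and embeddability descends along
surjections (`exists_embedding_of_cover`) by comparing eigencomponents in the enveloping algebra of
the kernel pair.

The counit is surjective because `A` is generated by grouplikes and generalized primitives. It is
injective because a bialgebra map out of `W(L)` that is injective on the span of `G` and on `L` is
injective (`bialgHom_injective`): along the filtration by degree in the primitives, a kernel element
can be corrected by lower terms until it is primitive. -/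

namespace GRigid

/-! ### Spans of powers, and the eigenvalues `2 ^ n`. -/

section Powers

/-- Uniqueness of decompositions in an independent family. It serves to isolate the linear component
of an element and to reflect gradings. -/
theorem eq_single_of_sum_eq {R N ι : Type*} [Ring R] [AddCommGroup N] [Module R N]
    {p : ι → Submodule R N} (hp : iSupIndep p) {c : ι →₀ N} (hc : ∀ i, c i ∈ p i) {j : ι} {v : N}
    (hv : v ∈ p j) (h : (c.sum fun _ x => x) = v) : c = Finsupp.single j v := by
  classical
  rw [← sub_eq_zero]
  set d := c - Finsupp.single j v with hd
  have hsum : (d.sum fun _ x => x) = 0 := by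
    rw [hd, Finsupp.sum_sub_index (fun _ _ _ => rfl), h, Finsupp.sum_single_index rfl, sub_self]
  have hmem : ∀ i, d i ∈ p i := fun i => by
    rw [hd, Finsupp.sub_apply, Finsupp.single_apply]
    refine (p i).sub_mem (hc i) ?_
    split_ifs with hij
    · exact hij ▸ hv
    · exact (p i).zero_mem
  have := (iSupIndep_iff_finsetSum_eq_zero_imp_eq_zero p).1 hp d.support d
    (fun i _ => hmem i) hsum
  ext i
  by_cases hi : i ∈ d.support
  · exact this i hi
  · simpa using hi

variable {k : Type*} [Field k] [CharZero k]

/-- If all values of a polynomial with vector coefficients lie in a subspace, so do the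
coefficients. -/
theorem coeff_mem_of_forall_sum_mem {B : Type*} [AddCommGroup B] [Module k B] (N : Submodule k B)
    (n : ℕ) (c : ℕ → B) (h : ∀ t : k, ∑ i ∈ Finset.range n, t ^ i • c i ∈ N) {i : ℕ}
    (hi : i < n) : c i ∈ N := by
  by_contra hc
  -- A functional that kills `N` but not `c i` turns the hypothesis into the vanishing of a scalar
  -- polynomial at every point of an infinite field.
  obtain ⟨f, hf, hN⟩ := Submodule.exists_le_ker_of_notMem hc
  let P : Polynomial k := ∑ j ∈ Finset.range n, Polynomial.monomial j (f (c j))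
  have hP : P = 0 := by
    refine Polynomial.funext fun t => ?_
    have := hN (h t)
    rw [LinearMap.mem_ker, map_sum] at this
    simpa [P, Polynomial.eval_finsetSum, mul_comm] using this
  have := congrArg (fun p => p.coeff i) hP
  simp [P, Polynomial.finsetSum_coeff, Polynomial.coeff_monomial, hi] at this
  exact hf this

variable {B : Type*} [Ring B] [Algebra k B]

-- Only the coefficient of `t` is needed later; the constant coefficient is carried along because
-- the induction step for `c 1` uses it.
omit [CharZero k] in
theorem exists_coeffs_add_smul_pow (x y : B) (n : ℕ) :
    ∃ c : ℕ → B, c 1 = ∑ i ∈ Finset.range n, x ^ i * y * x ^ (n - 1 - i) ∧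
      c 0 = x ^ n ∧ ∀ t : k, (x + t • y) ^ n = ∑ i ∈ Finset.range (n + 1), t ^ i • c i := by
  induction n with
  | zero => exact ⟨fun i => if i = 0 then 1 else 0, by simp, by simp, by simp⟩
  | succ n ih =>
    obtain ⟨c, h1, h0, h⟩ := ih
    -- Coefficients of `(x + t y)` times the previous expansion. The guard is needed because `c i`
    -- is arbitrary for `i > n`; the second summand shifts the index by one.
    refine ⟨fun i => (if i < n + 1 then x * c i else 0) + (if i = 0 then 0 else y * c (i - 1)),
      ?_, by simp [h0, pow_succ'], fun t => ?_⟩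
    · rw [Finset.sum_range_succ']
      have e : ∀ i ∈ Finset.range n, x ^ (i + 1) * y * x ^ (n + 1 - 1 - (i + 1)) =
          x * (x ^ i * y * x ^ (n - 1 - i)) := fun i _ => by
        rw [show n + 1 - 1 - (i + 1) = n - 1 - i by omega, pow_succ']
        simp only [mul_assoc]
      rw [Finset.sum_congr rfl e, ← Finset.mul_sum, ← h1]
      rcases n with _ | n
      · simp [h0, h1]
      · simp [h0]
    · rw [pow_succ', h, add_mul, Finset.mul_sum, Finset.mul_sum]
      simp only [smul_add, Finset.sum_add_distrib]
      congr 1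
      · rw [Finset.sum_range_succ _ (n + 1)]
        simp only [lt_irrefl, if_false, smul_zero, add_zero]
        refine Finset.sum_congr rfl fun i hi => ?_
        rw [if_pos (Finset.mem_range.1 hi), mul_smul_comm]
      · rw [Finset.sum_range_succ' _ (n + 1)]
        simp [pow_succ, smul_smul, mul_comm]

/-- The span of the powers `x ^ m` with `x ∈ V` and `m ≤ n`. -/
def powLE (V : Submodule k B) (n : ℕ) : Submodule k B :=
  Submodule.span k {b | ∃ m ≤ n, ∃ x ∈ V, x ^ m = b}

omit [CharZero k] in
theorem pow_mem_powLE (V : Submodule k B) {m n : ℕ} (h : m ≤ n) {x : B} (hx : x ∈ V) :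
    x ^ m ∈ powLE V n :=
  Submodule.subset_span ⟨m, h, x, hx, rfl⟩

omit [CharZero k] in
theorem powLE_mono (V : Submodule k B) : Monotone (powLE V) := fun _ _ h =>
  Submodule.span_mono fun _ ⟨m, hm, hx⟩ => ⟨m, hm.trans h, hx⟩

/-- Moving `y` past one `x` costs a commutator, which again lies in `V`, so modulo shorter products
all placements of `y` among the `x` agree. Their sum is the linear coefficient of `(x + t y) ^ (m +
1)`, hence a combination of powers, and dividing by the number of placements gives each one. -/
theorem pow_mul_mul_pow_mem (V : Submodule k B)
    (hV : ∀ x ∈ V, ∀ y ∈ V, x * y - y * x ∈ V) (m : ℕ) :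
    ∀ x ∈ V, ∀ y ∈ V, ∀ i j, i + j = m → x ^ i * y * x ^ j ∈ powLE V (m + 1) := by
  induction m with
  | zero =>
    intro x _ y hy i j hij
    obtain ⟨rfl, rfl⟩ : i = 0 ∧ j = 0 := by omega
    simpa using pow_mem_powLE V (le_refl 1) hy
  | succ m ih =>
    intro x hx y hy
    have step : ∀ i j, i + j = m →
        x ^ (i + 1) * y * x ^ j - x ^ i * y * x ^ (j + 1) ∈ powLE V (m + 1) := by
      intro i j hij
      have e : x ^ (i + 1) * y * x ^ j - x ^ i * y * x ^ (j + 1) =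
          x ^ i * (x * y - y * x) * x ^ j := by
        rw [pow_succ, pow_succ']; noncomm_ring
      rw [e]
      exact ih x hx _ (hV x hx y hy) i j hij
    have diff : ∀ i j, i + j = m + 1 →
        x ^ i * y * x ^ j - y * x ^ (m + 1) ∈ powLE V (m + 1) := by
      intro i
      induction i with
      | zero =>
        intro j hij
        obtain rfl : j = m + 1 := by omega
        simp
      | succ i ih' =>
        intro j hij
        have := Submodule.add_mem _ (step i j (by omega)) (ih' (j + 1) (by omega))
        rwa [sub_add_sub_cancel] at this
    have hsum : ∑ i ∈ Finset.range (m + 2), x ^ i * y * x ^ (m + 1 - i) ∈ powLE V (m + 2) := by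
      obtain ⟨c, h1, -, h⟩ := exists_coeffs_add_smul_pow (k := k) x y (m + 2)
      have := coeff_mem_of_forall_sum_mem (powLE V (m + 2)) (m + 2 + 1) c (fun t => by
        rw [← h t]
        exact pow_mem_powLE V le_rfl (V.add_mem hx (V.smul_mem t hy))) (i := 1) (by omega)
      rwa [h1] at this
    -- The sum is `(m + 2) • (y * x ^ (m + 1))` up to lower terms; characteristic zero allows the
    -- division.
    have hy' : y * x ^ (m + 1) ∈ powLE V (m + 2) := by
      have h2 : ∑ i ∈ Finset.range (m + 2), (x ^ i * y * x ^ (m + 1 - i) - y * x ^ (m + 1)) ∈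
          powLE V (m + 2) := Submodule.sum_mem _ fun i hi =>
        powLE_mono V (by omega) (diff i (m + 1 - i) (by have := Finset.mem_range.1 hi; omega))
      have h3 := Submodule.sub_mem _ hsum h2
      rw [← Finset.sum_sub_distrib] at h3
      simp only [sub_sub_cancel, Finset.sum_const, Finset.card_range] at h3
      rw [← Nat.cast_smul_eq_nsmul k] at h3
      exact (Submodule.smul_mem_iff _ (Nat.cast_ne_zero.2 (by omega))).1 h3
    intro i j hij
    have := Submodule.add_mem _ (powLE_mono V (Nat.le_succ (m + 1)) (diff i j hij)) hy'
    rwa [sub_add_cancel] at this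

/-- In characteristic zero, the span of the powers of the elements of a Lie subalgebra of an
associative algebra is closed under multiplication by these elements. -/
theorem mul_mem_span_pow (V : Submodule k B) (hV : ∀ x ∈ V, ∀ y ∈ V, x * y - y * x ∈ V)
    {y b : B} (hy : y ∈ V) (hb : b ∈ Submodule.span k {b | ∃ m : ℕ, ∃ x ∈ V, x ^ m = b}) :
    y * b ∈ Submodule.span k {b | ∃ m : ℕ, ∃ x ∈ V, x ^ m = b} := by
  induction hb using Submodule.span_induction with
  | mem b hb =>
    obtain ⟨m, x, hx, rfl⟩ := hb
    have := pow_mul_mul_pow_mem V hV m x hx y hy 0 m (zero_add m)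
    rw [pow_zero, one_mul] at this
    refine Submodule.span_mono ?_ this
    exact fun _ ⟨n, _, h⟩ => ⟨n, h⟩
  | zero => rw [mul_zero]; exact Submodule.zero_mem _
  | add a b _ _ ha hb => rw [mul_add]; exact Submodule.add_mem _ ha hb
  | smul c b _ hb => rw [mul_smul_comm]; exact Submodule.smul_mem _ c hb

-- The factor `a ⊗ 1` can be pulled out of the multiplication map on the left and `1 ⊗ a` on the
-- right, so each further factor contributes `a` twice. No binomial expansion is required.
omit [CharZero k] in
theorem mul'_primitive_pow (a : B) (n : ℕ) :
    LinearMap.mul' k B ((a ⊗ₜ[k] 1 + 1 ⊗ₜ[k] a : B ⊗[k] B) ^ n) = (2 : k) ^ n • a ^ n := by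
  have hl : ∀ t : B ⊗[k] B,
      LinearMap.mul' k B ((a ⊗ₜ[k] 1) * t) = a * LinearMap.mul' k B t := by
    intro t
    induction t using TensorProduct.induction_on with
    | zero => simp
    | tmul x y => simp [mul_assoc]
    | add x y hx hy => rw [mul_add, map_add, map_add, mul_add, hx, hy]
  have hr : ∀ t : B ⊗[k] B,
      LinearMap.mul' k B (t * (1 ⊗ₜ[k] a)) = LinearMap.mul' k B t * a := by
    intro t
    induction t using TensorProduct.induction_on with
    | zero => simp
    | tmul x y => simp [mul_assoc]
    | add x y hx hy => rw [add_mul, map_add, map_add, add_mul, hx, hy]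
  have hc : Commute (1 ⊗ₜ[k] a : B ⊗[k] B) (a ⊗ₜ[k] 1 + 1 ⊗ₜ[k] a) := by
    refine Commute.add_right ?_ (Commute.refl _)
    simp [Commute, SemiconjBy]
  induction n with
  | zero => simp [Algebra.TensorProduct.one_def]
  | succ n ih =>
    rw [pow_succ', add_mul, (hc.pow_right n).eq, map_add, hl, hr, ih, mul_smul_comm,
      smul_mul_assoc, ← pow_succ', ← pow_succ, ← two_smul k, smul_smul, pow_succ' (2 : k)]

/-- Characteristic zero makes the eigenvalues `2 ^ n` pairwise distinct. -/
theorem iSupIndep_of_eigen {M : Type*} [AddCommGroup M] [Module k M] (ψ : Module.End k M)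
    (p : ℕ → Submodule k M) (h : ∀ n, ∀ x ∈ p n, ψ x = (2 : k) ^ n • x) : iSupIndep p := by
  have hinj : Function.Injective fun n : ℕ => (2 : k) ^ n := by
    intro m n hmn
    have : ((2 ^ m : ℕ) : k) = ((2 ^ n : ℕ) : k) := by simpa using hmn
    exact Nat.pow_right_injective le_rfl (Nat.cast_injective this)
  exact ((Module.End.eigenspaces_iSupIndep ψ).comp hinj).mono fun n x hx =>
    Module.End.mem_eigenspace_iff.2 (h n x hx)

end Powers

/-! ### Enveloping algebras: decomposition into spans of powers, and descent of embeddings along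
surjections. -/

section Embedding

attribute [local instance 100] LieRing.ofAssociativeRing

variable {k : Type*} [Field k]

section UEA

variable (L : Type*) [LieRing L] [LieAlgebra k L]

local notation "𝓤" => UniversalEnvelopingAlgebra k

/-- The span of the `n`-th powers of the elements of a Lie algebra in its enveloping algebra. -/
def ueaPow (n : ℕ) : Submodule k (𝓤 L) :=
  Submodule.span k {a | ∃ x : L, UniversalEnvelopingAlgebra.ι k x ^ n = a}

theorem ueaPow_one : ueaPow (k := k) L 1 = LinearMap.range
    (UniversalEnvelopingAlgebra.ι k : L →ₗ⁅k⁆ 𝓤 L).toLinearMap := by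
  rw [ueaPow, ← Submodule.span_eq (LinearMap.range _)]
  congr 1
  ext a
  simp

/-- The coproduct of the enveloping algebra. -/
noncomputable def ueaComul : 𝓤 L →ₐ[k] 𝓤 L ⊗[k] 𝓤 L :=
  UniversalEnvelopingAlgebra.lift k
    { toFun := fun x => UniversalEnvelopingAlgebra.ι k x ⊗ₜ 1 + 1 ⊗ₜ UniversalEnvelopingAlgebra.ι k x
      map_add' := fun x y => by
        rw [map_add, TensorProduct.add_tmul, TensorProduct.tmul_add]; abel
      map_smul' := fun c x => by
        rw [map_smul, RingHom.id_apply, smul_add, TensorProduct.smul_tmul',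
          TensorProduct.tmul_smul]
      map_lie' := fun {x y} => by
        simp only [LieHom.map_lie, LieRing.of_associative_ring_bracket, mul_add, add_mul,
          Algebra.TensorProduct.tmul_mul_tmul, TensorProduct.sub_tmul, TensorProduct.tmul_sub,
          one_mul, mul_one]
        abel }

theorem ueaComul_ι (x : L) : ueaComul L (UniversalEnvelopingAlgebra.ι k x) =
    UniversalEnvelopingAlgebra.ι k x ⊗ₜ 1 + 1 ⊗ₜ UniversalEnvelopingAlgebra.ι k x :=
  UniversalEnvelopingAlgebra.lift_ι_apply k _ x

variable [CharZero k]

/-- Comultiplying and then multiplying acts on `n`-th powers of primitives as `2 ^ n`. -/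
theorem iSupIndep_ueaPow : iSupIndep (ueaPow (k := k) L) := by
  refine iSupIndep_of_eigen (LinearMap.mul' k (𝓤 L) ∘ₗ (ueaComul L).toLinearMap) _ fun n a ha => ?_
  induction ha using Submodule.span_induction with
  | mem a ha =>
    obtain ⟨x, rfl⟩ := ha
    simp only [LinearMap.comp_apply, AlgHom.toLinearMap_apply, map_pow, ueaComul_ι]
    exact mul'_primitive_pow _ n
  | zero => simp
  | add a b _ _ ha hb => rw [map_add, ha, hb, smul_add]
  | smul c a _ ha => rw [map_smul, ha, smul_comm]

theorem iSup_ueaPow : ⨆ n, ueaPow (k := k) L n = ⊤ := by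
  let V := LinearMap.range (UniversalEnvelopingAlgebra.ι k : L →ₗ⁅k⁆ 𝓤 L).toLinearMap
  have hV : ∀ x ∈ V, ∀ y ∈ V, x * y - y * x ∈ V := by
    rintro _ ⟨x, rfl⟩ _ ⟨y, rfl⟩
    exact ⟨⁅x, y⁆, LieHom.map_lie _ x y⟩
  -- By the universal property, the identity of the enveloping algebra factors through the
  -- subalgebra generated by `L`.
  have hadj : Algebra.adjoin k (V : Set (𝓤 L)) = ⊤ := by
    let S := Algebra.adjoin k (V : Set (𝓤 L))
    let f : 𝓤 L →ₐ[k] S := UniversalEnvelopingAlgebra.lift k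
      { toFun := fun x => ⟨UniversalEnvelopingAlgebra.ι k x, Algebra.subset_adjoin ⟨x, rfl⟩⟩
        map_add' := fun x y => Subtype.ext (map_add _ x y)
        map_smul' := fun c x => Subtype.ext (map_smul _ c x)
        map_lie' := fun {x y} => Subtype.ext (LieHom.map_lie _ x y) }
    have h : S.val.comp f = AlgHom.id k _ := by
      refine UniversalEnvelopingAlgebra.hom_ext k (LieHom.ext fun x => ?_)
      change (f (UniversalEnvelopingAlgebra.ι k x) : 𝓤 L) = _
      simp only [f, UniversalEnvelopingAlgebra.lift_ι_apply]
      rfl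
    rw [eq_top_iff]
    intro a _
    rw [← AlgHom.id_apply (R := k) a, ← h]
    exact (f a).2
  have key : ∀ a, a ∈ Submodule.span k {b | ∃ m : ℕ, ∃ x ∈ V, x ^ m = b} := by
    intro a
    have ha : a ∈ Algebra.adjoin k (V : Set (𝓤 L)) := by rw [hadj]; trivial
    rw [← Subalgebra.mem_toSubmodule, Algebra.adjoin_eq_span] at ha
    refine Submodule.span_le.2 (fun b hb => ?_) ha
    induction hb using Submonoid.closure_induction_left with
    | one => exact Submodule.subset_span ⟨0, 0, V.zero_mem, pow_zero _⟩
    | mul_left x hx y _ ih => exact mul_mem_span_pow V hV hx ih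
  rw [eq_top_iff]
  intro a _
  refine Submodule.span_le.2 ?_ (key a)
  rintro _ ⟨m, _, ⟨x, rfl⟩, rfl⟩
  exact le_iSup (ueaPow (k := k) L) m (Submodule.subset_span ⟨x, rfl⟩)

end UEA

section Cover

variable {F L : Type*} [LieRing F] [LieAlgebra k F] [LieRing L] [LieAlgebra k L] (p : F →ₗ⁅k⁆ L)

local notation "𝓤" => UniversalEnvelopingAlgebra k

/-- The kernel pair of a homomorphism of Lie algebras. -/
def kernelPair : LieSubalgebra k (F × F) where
  carrier := {z | p z.1 = p z.2}
  add_mem' := fun {a b} ha hb => by simp_all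
  zero_mem' := by simp
  smul_mem' := fun c a ha => by simp_all
  lie_mem' := fun {a b} ha hb => by simp_all

/-- The first projection of the kernel pair, on enveloping algebras. -/
noncomputable def ueaFst : 𝓤 (kernelPair p) →ₐ[k] 𝓤 F :=
  UniversalEnvelopingAlgebra.lift k ((UniversalEnvelopingAlgebra.ι k).comp
    ((LieHom.fst k F F).comp (kernelPair p).incl))

/-- The second projection of the kernel pair, on enveloping algebras. -/
noncomputable def ueaSnd : 𝓤 (kernelPair p) →ₐ[k] 𝓤 F :=
  UniversalEnvelopingAlgebra.lift k ((UniversalEnvelopingAlgebra.ι k).comp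
    ((LieHom.snd k F F).comp (kernelPair p).incl))

/-- The diagonal of the kernel pair, on enveloping algebras. -/
noncomputable def ueaDiag : 𝓤 F →ₐ[k] 𝓤 (kernelPair p) :=
  UniversalEnvelopingAlgebra.lift k ((UniversalEnvelopingAlgebra.ι k).comp
    { toFun := fun x => (⟨(x, x), rfl⟩ : kernelPair p)
      map_add' := fun _ _ => rfl
      map_smul' := fun _ _ => rfl
      map_lie' := rfl })

theorem ueaFst_ι (z : kernelPair p) : ueaFst p (UniversalEnvelopingAlgebra.ι k z) =
    UniversalEnvelopingAlgebra.ι k z.1.1 :=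
  UniversalEnvelopingAlgebra.lift_ι_apply k _ z

theorem ueaSnd_ι (z : kernelPair p) : ueaSnd p (UniversalEnvelopingAlgebra.ι k z) =
    UniversalEnvelopingAlgebra.ι k z.1.2 :=
  UniversalEnvelopingAlgebra.lift_ι_apply k _ z

theorem ueaFst_diag (a : 𝓤 F) : ueaFst p (ueaDiag p a) = a := by
  have : (ueaFst p).comp (ueaDiag p) = AlgHom.id k _ := by
    refine UniversalEnvelopingAlgebra.hom_ext k (LieHom.ext fun x => ?_)
    change ueaFst p (ueaDiag p (UniversalEnvelopingAlgebra.ι k x)) = _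
    rw [ueaDiag, UniversalEnvelopingAlgebra.lift_ι_apply]
    exact ueaFst_ι p _
  exact DFunLike.congr_fun this a

/-- The kernel of the map of enveloping algebras induced by a surjective homomorphism `p`,
described by means of the kernel pair of `p`. -/
noncomputable def ueaKer : Ideal (𝓤 F) where
  carrier := {a | ∃ b, ueaSnd p b = 0 ∧ ueaFst p b = a}
  add_mem' := by
    rintro _ _ ⟨b, hb, rfl⟩ ⟨c, hc, rfl⟩
    exact ⟨b + c, by rw [map_add, hb, hc, add_zero], map_add _ _ _⟩
  zero_mem' := ⟨0, map_zero _, map_zero _⟩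
  smul_mem' := by
    rintro a _ ⟨b, hb, rfl⟩
    -- The diagonal lifts `a` to the enveloping algebra of the kernel pair, where the product can be
    -- formed without leaving the kernel of the second projection.
    exact ⟨ueaDiag p a * b, by rw [map_mul, hb, mul_zero], by
      rw [map_mul, ueaFst_diag, smul_eq_mul]⟩

instance : (ueaKer p).IsTwoSided where
  mul_mem_of_left := by
    rintro _ a ⟨b, hb, rfl⟩
    exact ⟨b * ueaDiag p a, by rw [map_mul, hb, zero_mul], by rw [map_mul, ueaFst_diag]⟩

theorem ι_mem_ueaKer {x : F} (hx : p x = 0) : UniversalEnvelopingAlgebra.ι k x ∈ ueaKer p :=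
  ⟨UniversalEnvelopingAlgebra.ι k ⟨(x, 0), hx.trans (map_zero p).symm⟩,
    (ueaSnd_ι p _).trans (map_zero _), ueaFst_ι p _⟩

/-- Both projections respect the decomposition into spans of powers, so a witness `b` may be
replaced by its linear component, which comes from a pair `z` in the kernel pair. Injectivity on `F`
forces `z = (x, 0)`, whence `p x = p 0`. -/
theorem eq_zero_of_ι_mem_ueaKer [CharZero k]
    (hF : Function.Injective (UniversalEnvelopingAlgebra.ι k : F →ₗ⁅k⁆ 𝓤 F)) {x : F}
    (hx : UniversalEnvelopingAlgebra.ι k x ∈ ueaKer p) : p x = 0 := by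
  obtain ⟨b, h2, h1⟩ := hx
  have hb : b ∈ ⨆ n, ueaPow (k := k) (kernelPair p) n := by rw [iSup_ueaPow]; trivial
  obtain ⟨c, hc, rfl⟩ := (Submodule.mem_iSup_iff_exists_finsupp _ _).1 hb
  have hmap : ∀ (φ : 𝓤 (kernelPair p) →ₐ[k] 𝓤 F),
      (∀ z, ∃ y, φ (UniversalEnvelopingAlgebra.ι k z) = UniversalEnvelopingAlgebra.ι k y) →
      ∀ v : F, φ (c.sum fun _ a => a) = UniversalEnvelopingAlgebra.ι k v →
      φ (c 1) = UniversalEnvelopingAlgebra.ι k v := by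
    intro φ hφ v hv
    have hmem : ∀ n, c.mapRange φ (map_zero φ) n ∈ ueaPow (k := k) F n := fun n => by
      rw [Finsupp.mapRange_apply]
      refine Submodule.span_le.2 ?_ (hc n) |> fun h => (h : c n ∈ (ueaPow F n).comap φ.toLinearMap)
      rintro _ ⟨z, rfl⟩
      obtain ⟨y, hy⟩ := hφ z
      exact Submodule.subset_span ⟨y, by rw [← hy]; exact (map_pow φ _ n).symm⟩
    have hv1 : UniversalEnvelopingAlgebra.ι k v ∈ ueaPow (k := k) F 1 := by
      rw [ueaPow_one]; exact ⟨v, rfl⟩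
    have := eq_single_of_sum_eq (iSupIndep_ueaPow F) hmem hv1 (by
      rw [Finsupp.sum_mapRange_index fun _ => rfl, ← hv, map_finsuppSum])
    simpa using DFunLike.congr_fun this 1
  have e1 := hmap (ueaFst p) (fun z => ⟨_, ueaFst_ι p z⟩) x h1
  have e2 := hmap (ueaSnd p) (fun z => ⟨_, ueaSnd_ι p z⟩) 0 (by rw [h2, map_zero])
  obtain ⟨z, hz⟩ := (ueaPow_one (k := k) (kernelPair p)).le (hc 1)
  change UniversalEnvelopingAlgebra.ι k z = c 1 at hz
  rw [← hz, ueaFst_ι] at e1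
  rw [← hz, ueaSnd_ι] at e2
  rw [← hF e1, show p z.1.1 = p z.1.2 from z.2, hF e2, map_zero]

/-- If `F` embeds in an associative algebra, so does every quotient `L` of `F`. -/
theorem exists_embedding_of_cover [CharZero k]
    (hF : Function.Injective (UniversalEnvelopingAlgebra.ι k : F →ₗ⁅k⁆ 𝓤 F))
    (hp : Function.Surjective p) :
    ∃ β : L →ₗ⁅k⁆ (𝓤 F ⧸ ueaKer p), Function.Injective β := by
  -- A linear section is enough: its failure to preserve brackets lies in the kernel of `p`, which
  -- the quotient by `ueaKer p` kills.
  obtain ⟨s, hs⟩ := (p : F →ₗ[k] L).exists_rightInverse_of_surjective (LinearMap.range_eq_top.2 hp)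
  have hs' : ∀ x, p (s x) = x := DFunLike.congr_fun hs
  let π := Ideal.Quotient.mkₐ k (ueaKer p)
  have hπ : ∀ a, π a = 0 ↔ a ∈ ueaKer p := fun a => Ideal.Quotient.eq_zero_iff_mem
  refine ⟨{ toLinearMap := π.toLinearMap ∘ₗ (UniversalEnvelopingAlgebra.ι k).toLinearMap ∘ₗ s
            map_lie' := fun {x y} => ?_ }, ?_⟩
  · change π (UniversalEnvelopingAlgebra.ι k (s ⁅x, y⁆)) =
      π (UniversalEnvelopingAlgebra.ι k (s x)) * π (UniversalEnvelopingAlgebra.ι k (s y)) -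
      π (UniversalEnvelopingAlgebra.ι k (s y)) * π (UniversalEnvelopingAlgebra.ι k (s x))
    rw [← map_mul π, ← map_mul π, ← map_sub π, ← LieRing.of_associative_ring_bracket, ← LieHom.map_lie,
      ← sub_eq_zero, ← map_sub, hπ, ← map_sub]
    exact ι_mem_ueaKer p (by rw [map_sub, LieHom.map_lie, hs', hs', hs', sub_self])
  · refine (injective_iff_map_eq_zero _).2 fun x hx => ?_
    rw [← hs' x]
    exact eq_zero_of_ι_mem_ueaKer p hF ((hπ _).1 hx)

end Cover

end Embedding

/-! ### A faithful representation of polynomial Lie algebras, and the embedding of an arbitrary Lie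
algebra. -/

section Loop

attribute [local instance 100] LieRing.ofAssociativeRing

open Polynomial

variable (k : Type*) [Field k] (L : Type*) [LieRing L] [LieAlgebra k L]

local notation "𝓤" => UniversalEnvelopingAlgebra k

/-- The Lie algebra `L[X]` of polynomials with coefficients in a Lie algebra `L`. -/
def PolyLie := k[X] ⊗[k] L

namespace PolyLie

noncomputable instance : LieRing (PolyLie k L) := inferInstanceAs (LieRing (k[X] ⊗[k] L))
noncomputable instance : LieAlgebra k (PolyLie k L) :=
  inferInstanceAs (LieAlgebra k (k[X] ⊗[k] L))

variable {k L} in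
/-- The element `f ⊗ x` of `L[X]`. -/
noncomputable def tmul (f : k[X]) (x : L) : PolyLie k L := f ⊗ₜ[k] x

variable {k L} in
theorem lie_tmul (f g : k[X]) (x y : L) : ⁅tmul f x, tmul g y⁆ = tmul (f * g) ⁅x, y⁆ := rfl

variable {k L} in
theorem add_tmul (f g : k[X]) (x : L) : tmul (f + g) x = tmul f x + tmul g x :=
  TensorProduct.add_tmul f g x

variable {k L} in
@[elab_as_elim]
theorem induction {P : PolyLie k L → Prop} (a : PolyLie k L) (zero : P 0)
    (tmul : ∀ f x, P (tmul f x)) (add : ∀ a b, P a → P b → P (a + b)) : P a :=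
  TensorProduct.induction_on (motive := P) a zero tmul add

/-- The linear map out of `L[X]` defined by a bilinear map. -/
noncomputable def lift {M : Type*} [AddCommGroup M] [Module k M] (f : k[X] →ₗ[k] L →ₗ[k] M) :
    PolyLie k L →ₗ[k] M :=
  TensorProduct.lift f

theorem lift_tmul {M : Type*} [AddCommGroup M] [Module k M] (φ : k[X] →ₗ[k] L →ₗ[k] M)
    (f : k[X]) (x : L) : lift k L φ (tmul f x) = φ f x := rfl

/-- Evaluation at `t` of polynomials with coefficients in a Lie algebra. -/
noncomputable def eval (t : k) : PolyLie k L →ₗ⁅k⁆ L where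
  toLinearMap := lift k L (LinearMap.lsmul k L ∘ₗ leval t)
  map_lie' := fun {a b} => by
    change lift k L _ _ = ⁅lift k L _ _, lift k L _ _⁆
    induction a using PolyLie.induction with
    | zero => simp
    | add a b ha hb => rw [add_lie, map_add, map_add, add_lie, ha, hb]
    | tmul f x =>
      induction b using PolyLie.induction with
      | zero => simp
      | add a b ha hb => rw [lie_add, map_add, map_add, lie_add, ha, hb]
      | tmul g y => simp [lie_tmul, lift_tmul, smul_smul, mul_comm]

theorem eval_tmul (t : k) (f : k[X]) (x : L) : eval k L t (tmul f x) = f.eval t • x := rfl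

/-- The Euler derivation `X d/dX`. -/
noncomputable def euler : PolyLie k L →ₗ[k] PolyLie k L :=
  (LinearMap.rTensor L (LinearMap.mulLeft k X ∘ₗ (derivative : k[X] →ₗ[k] k[X])) :
    k[X] ⊗[k] L →ₗ[k] k[X] ⊗[k] L)

theorem euler_tmul (f : k[X]) (x : L) :
    euler k L (tmul f x) = tmul (X * derivative f) x := rfl

theorem euler_lie (a b : PolyLie k L) :
    euler k L ⁅a, b⁆ = ⁅euler k L a, b⁆ + ⁅a, euler k L b⁆ := by
  induction a using PolyLie.induction with
  | zero => simp
  | add a b ha hb => rw [add_lie, map_add, map_add, add_lie, add_lie, ha, hb]; abel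
  | tmul f x =>
    induction b using PolyLie.induction with
    | zero => simp
    | add a b ha hb => rw [lie_add, map_add, map_add, lie_add, lie_add, ha, hb]; abel
    | tmul g y =>
      simp only [euler_tmul, lie_tmul, ← add_tmul, derivative_mul]
      congr 1
      ring

/-- Polynomials without constant term with coefficients in a Lie algebra. -/
noncomputable abbrev pos : LieSubalgebra k (PolyLie k L) :=
  (eval k L 0).ker.toLieSubalgebra k (PolyLie k L)

/-- The Euler derivation multiplies the coefficient of `X ^ n` by `n`. For `n > 0` this is
invertible in characteristic zero, and the constant coefficient vanishes by assumption. -/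
theorem eq_zero_of_euler_eq_zero [CharZero k] {a : PolyLie k L} (h0 : eval k L 0 a = 0)
    (ha : euler k L a = 0) : a = 0 := by
  let c : PolyLie k L ≃ₗ[k] ℕ →₀ L :=
    TensorProduct.equivFinsuppOfBasisLeft (N := L) (Polynomial.basisMonomials k)
  have hc : ∀ (f : k[X]) (x : L) n, c (tmul f x) n = f.coeff n • x := fun f x n =>
    TensorProduct.equivFinsuppOfBasisLeft_apply_tmul_apply ..
  have h1 : ∀ (b : PolyLie k L) n, c (euler k L b) n = (n : k) • c b n := by
    intro b n
    induction b using PolyLie.induction with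
    | zero => simp
    | add a b ha hb => simp only [map_add, Finsupp.add_apply, ha, hb, smul_add]
    | tmul f x =>
      rw [euler_tmul, hc, hc, smul_smul]
      rcases n with _ | n
      · simp
      · rw [coeff_X_mul, coeff_derivative]
        push_cast
        rw [mul_comm]
  have h2 : ∀ b : PolyLie k L, c b 0 = eval k L 0 b := by
    intro b
    induction b using PolyLie.induction with
    | zero => simp
    | add a b ha hb => simp only [map_add, Finsupp.add_apply, ha, hb]
    | tmul f x => rw [hc, eval_tmul, coeff_zero_eq_eval_zero]
  apply c.injective
  rw [map_zero]
  ext n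
  rcases n with _ | n
  · rw [h2, h0]; rfl
  · have := h1 a (n + 1)
    rw [ha, map_zero, Finsupp.zero_apply, eq_comm, smul_eq_zero] at this
    exact this.resolve_left (Nat.cast_ne_zero.2 (Nat.succ_ne_zero n))

/-- The affine representation of `L[X]` given by the adjoint representation and the Euler
derivation. -/
noncomputable def rep : PolyLie k L →ₗ⁅k⁆ Module.End k (PolyLie k L × k) where
  toFun a := LinearMap.inl k _ k ∘ₗ
    ((LieAlgebra.ad k (PolyLie k L) a).coprod
      (LinearMap.toSpanSingleton k _ (euler k L a)))
  map_add' a b := by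
    refine LinearMap.ext fun y => Prod.ext ?_ ?_
    · simp; abel
    · simp
  map_smul' c a := by
    refine LinearMap.ext fun y => Prod.ext ?_ ?_
    · change ⁅c • a, y.1⁆ + y.2 • euler k L (c • a) = c • (⁅a, y.1⁆ + y.2 • euler k L a)
      rw [smul_lie, map_smul, smul_add, smul_comm]
    · exact (smul_zero c).symm
  -- The first component is the Jacobi identity together with the derivation property of `euler`,
  -- which makes it a 1-cocycle for the adjoint action.
  map_lie' := fun {a b} => by
    refine LinearMap.ext fun y => Prod.ext ?_ ?_
    · change ⁅⁅a, b⁆, y.1⁆ + y.2 • euler k L ⁅a, b⁆ =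
        (⁅a, ⁅b, y.1⁆ + y.2 • euler k L b⁆ + (0 : k) • euler k L a) -
        (⁅b, ⁅a, y.1⁆ + y.2 • euler k L a⁆ + (0 : k) • euler k L b)
      rw [euler_lie, lie_lie, lie_add, lie_add, lie_smul, lie_smul, zero_smul, zero_smul,
        ← lie_skew (euler k L a) b, smul_add, smul_neg]
      abel
    · change (0 : k) = 0 - 0
      rw [sub_zero]

theorem rep_apply (a : PolyLie k L) : rep k L a (0, 1) = (euler k L a, 0) := by
  simp [rep]

/-- The affine representation factors through the enveloping algebra and sends `(0, 1)` to `(euler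
a, 0)`, so it detects every `a` without constant term, even a central one. -/
theorem ι_pos_injective [CharZero k] :
    Function.Injective (UniversalEnvelopingAlgebra.ι k : pos k L →ₗ⁅k⁆ 𝓤 (pos k L)) := by
  refine (injective_iff_map_eq_zero _).2 fun a ha => Subtype.ext ?_
  refine eq_zero_of_euler_eq_zero k L (LieHom.mem_ker.1 a.2) ?_
  have h := UniversalEnvelopingAlgebra.lift_ι_apply k
    ((rep k L).comp (pos k L).incl) a
  rw [ha, map_zero] at h
  have := rep_apply k L a.1
  change 0 = rep k L a.1 at h
  rw [← h] at this
  exact (congrArg Prod.fst this).symm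

end PolyLie

/-- Every Lie algebra over a field of characteristic zero embeds in an associative algebra. -/
theorem exists_embedding [CharZero k] :
    ∃ (p : PolyLie.pos k L →ₗ⁅k⁆ L) (β : L →ₗ⁅k⁆ (𝓤 (PolyLie.pos k L) ⧸ ueaKer p)),
      Function.Injective β := by
  refine ⟨(PolyLie.eval k L 1).comp (PolyLie.pos k L).incl,
    exists_embedding_of_cover _
    -- `X ⊗ x` vanishes at `0` and takes the value `x` at `1`.
    (PolyLie.ι_pos_injective k L) fun x => ⟨⟨PolyLie.tmul X x, ?_⟩, ?_⟩⟩
  · change PolyLie.eval k L 0 (PolyLie.tmul X x) = 0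
    rw [PolyLie.eval_tmul, eval_X, zero_smul]
  · change PolyLie.eval k L 1 (PolyLie.tmul X x) = x
    rw [PolyLie.eval_tmul, eval_X, one_smul]

end Loop

/-! ### Suspensive Lie algebras over a group: translation to degree one, and gradings. -/

namespace SuspLie

variable {k : Type u} [Field k] {G : Type v} [CommGroup G] (L : SuspLie.{u, v, w} k G)

theorem act_inv_act (g : G) (x : L.carrier) : L.act g⁻¹ (L.act g x) = x := by
  rw [← Module.End.mul_apply, ← map_mul, inv_mul_cancel, map_one, Module.End.one_apply]

theorem act_act_inv (g : G) (x : L.carrier) : L.act g (L.act g⁻¹ x) = x := by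
  rw [← Module.End.mul_apply, ← map_mul, mul_inv_cancel, map_one, Module.End.one_apply]

theorem act_inv_mem {g : G} {x : L.carrier} (hx : x ∈ L.deg g) : L.act g⁻¹ x ∈ L.deg 1 := by
  simpa using L.act_mem g⁻¹ hx

theorem exists_homogeneous_sum (x : L.carrier) :
    ∃ c : G →₀ L.carrier, (∀ g, c g ∈ L.deg g) ∧ (c.sum fun _ y => y) = x := by
  classical
  refine (Submodule.mem_iSup_iff_exists_finsupp L.deg x).1 ?_
  rw [L.isInternal.submodule_iSup_eq_top]
  trivial

/-- An injective linear map which preserves gradings also reflects them. -/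
theorem mem_deg_of_map_mem {M : Type*} [AddCommGroup M] [Module k M] (f : L.carrier →ₗ[k] M)
    (hf : Function.Injective f) {p : G → Submodule k M} (hp : iSupIndep p)
    (h : ∀ g, ∀ x ∈ L.deg g, f x ∈ p g) {g : G} {x : L.carrier} (hx : f x ∈ p g) :
    x ∈ L.deg g := by
  obtain ⟨c, hc, rfl⟩ := L.exists_homogeneous_sum x
  have := eq_single_of_sum_eq hp (c := c.mapRange f (map_zero f))
    (fun i => by rw [Finsupp.mapRange_apply]; exact h i _ (hc i)) hx
    (by rw [Finsupp.sum_mapRange_index fun _ => rfl, map_finsuppSum])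
  have h1 := DFunLike.congr_fun this g
  rw [Finsupp.mapRange_apply, Finsupp.single_eq_same] at h1
  rw [← hf h1]
  exact hc g

end SuspLie

/-! ### Structure of `W(L)`: injectivity of `L → W(L)`, a spanning set, and the primitives. -/

namespace WAlg

variable {k : Type u} [Field k] {G : Type v} [CommGroup G] (L : SuspLie.{u, v, w} k G)

section Injective

attribute [local instance 100] LieRing.ofAssociativeRing

variable {L} {B : Type*} [Ring B] [Algebra k B] (β : L.carrier →ₗ⁅k⁆ B)

/-- The linear map from `L` to the group algebra of `G` over `B` which sends `x` of degree `Q` to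
`β (Q⁻¹ x) Q`. -/
noncomputable def twist : L.carrier →ₗ[k] MonoidAlgebra B G :=
  L.ofComponents fun Q => MonoidAlgebra.lsingle (R := k) Q ∘ₗ β.toLinearMap ∘ₗ L.act Q⁻¹

theorem twist_apply {Q : G} {x : L.carrier} (hx : x ∈ L.deg Q) :
    twist β x = MonoidAlgebra.single Q (β (L.act Q⁻¹ x)) := by
  rw [twist, L.ofComponents_apply _ hx]; rfl

theorem of_mul_twist (g : G) (x : L.carrier) :
    MonoidAlgebra.of B G g * twist β x = twist β (L.act g x) := by
  refine L.homog_induction (p := fun x => MonoidAlgebra.of B G g * twist β x = twist β (L.act g x)) (fun Q x hx => ?_)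
    (fun x y hx hy => by rw [map_add, mul_add, hx, hy, map_add, map_add]) x
  rw [twist_apply β hx, twist_apply β (L.act_mem g hx), MonoidAlgebra.of_apply,
    MonoidAlgebra.single_mul_single, one_mul, mul_inv_rev, map_mul, Module.End.mul_apply,
    L.act_inv_act]

theorem of_comm_twist (g : G) (x : L.carrier) :
    MonoidAlgebra.of B G g * twist β x = twist β x * MonoidAlgebra.of B G g := by
  refine L.homog_induction (p := fun x => MonoidAlgebra.of B G g * twist β x =
    twist β x * MonoidAlgebra.of B G g) (fun Q x hx => ?_)
    (fun x y hx hy => by rw [map_add, mul_add, hx, hy, add_mul]) x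
  rw [twist_apply β hx, MonoidAlgebra.of_apply,
    MonoidAlgebra.single_mul_single, MonoidAlgebra.single_mul_single, one_mul, mul_one, mul_comm]

/-- By bilinearity over `kG`, `(Q R)⁻¹ [x, y] = [Q⁻¹ x, R⁻¹ y]`; commutativity of `G` puts both
products of the commutator in the same degree. -/
theorem twist_lie (x y : L.carrier) :
    twist β ⁅x, y⁆ = twist β x * twist β y - twist β y * twist β x := by
  refine L.homog_induction (p := fun x => twist β ⁅x, y⁆ = twist β x * twist β y -
    twist β y * twist β x) (fun Q x hx => ?_)
    (fun x z hx hz => by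
      rw [add_lie, map_add, map_add, add_mul, mul_add, hx, hz]; abel) x
  refine L.homog_induction (p := fun y => twist β ⁅x, y⁆ = twist β x * twist β y -
    twist β y * twist β x) (fun R y hy => ?_)
    (fun y z hy hz => by
      rw [lie_add, map_add, map_add, add_mul, mul_add, hy, hz]; abel) y
  rw [twist_apply β hx, twist_apply β hy, twist_apply β (L.lie_mem hx hy),
    MonoidAlgebra.single_mul_single, MonoidAlgebra.single_mul_single, mul_comm R Q,
    ← MonoidAlgebra.single_sub, ← LieRing.of_associative_ring_bracket, ← LieHom.map_lie,
    L.act_lie, L.lie_act, mul_inv, map_mul, Module.End.mul_apply]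

theorem twist_injective (hβ : Function.Injective β) : Function.Injective (twist β) := by
  refine (injective_iff_map_eq_zero _).2 fun x hx => ?_
  obtain ⟨c, hc, rfl⟩ := L.exists_homogeneous_sum x
  suffices c = 0 by rw [this, Finsupp.sum_zero_index]
  have h1 : ∀ g, β (L.act g⁻¹ (c g)) = 0 := fun g => by
    have h2 := congrArg (fun z => z.coeff g) hx
    simp only [map_finsuppSum, MonoidAlgebra.coeff_zero, Finsupp.zero_apply] at h2
    rw [← h2, Finsupp.sum, MonoidAlgebra.coeff_sum, Finsupp.finsetSum_apply]
    simp only [twist_apply β (hc _), MonoidAlgebra.coeff_single]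
    by_cases hg : g ∈ c.support
    · rw [Finset.sum_eq_single_of_mem g hg fun h _ hh => Finsupp.single_eq_of_ne hh.symm,
        Finsupp.single_eq_same]
    · rw [Finset.sum_eq_zero fun h hh => Finsupp.single_eq_of_ne (fun e : g = h => hg (e ▸ hh)),
        Finsupp.notMem_support_iff.1 hg, map_zero, map_zero]
  ext g
  rw [Finsupp.zero_apply, ← L.act_act_inv g (c g), hβ ((h1 g).trans (map_zero β).symm), map_zero]

/-- The injective map `twist β` satisfies the relations of `W(L)`, so it factors through `ι L`. -/
theorem ι_injective_of_embedding (hβ : Function.Injective β) : Function.Injective (ι L) := by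
  refine (injective_iff_map_eq_zero _).2 fun x hx => ?_
  have := lift_ι (MonoidAlgebra.of B G : G →* MonoidAlgebra B G) (twist β) (of_comm_twist β) (twist_lie β)
    (of_mul_twist β) x
  rw [hx, map_zero] at this
  exact twist_injective β hβ (this.symm.trans (map_zero _).symm)

variable (L) in
/-- The natural map `L → W(L)` is injective. -/
theorem ι_injective [CharZero k] : Function.Injective (ι L) := by
  obtain ⟨_, β, hβ⟩ := exists_embedding k L.carrier
  exact ι_injective_of_embedding β hβ

end Injective

section Span

/-- The image in `W(L)` of the component of `L` of degree `1`. -/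
noncomputable def degOne : Submodule k (WAlg L) := (L.deg 1).map (ι L)

theorem degOne_commutator {a b : WAlg L} (ha : a ∈ degOne L) (hb : b ∈ degOne L) :
    a * b - b * a ∈ degOne L := by
  obtain ⟨x, hx, rfl⟩ := ha
  obtain ⟨y, hy, rfl⟩ := hb
  exact ⟨⁅x, y⁆, by simpa using L.lie_mem hx hy, ι_lie L x y⟩

theorem comul_degOne {a : WAlg L} (ha : a ∈ degOne L) : comul L a = a ⊗ₜ 1 + 1 ⊗ₜ a := by
  obtain ⟨x, hx, rfl⟩ := ha
  rw [comul_ι L hx, gl_one]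

/-- Invertibility of `Q` is what reduces generalized primitives to ordinary ones. -/
theorem ι_eq_gl_mul {Q : G} {x : L.carrier} (hx : x ∈ L.deg Q) :
    ∃ a ∈ degOne L, ι L x = gl L Q * a :=
  ⟨_, ⟨_, L.act_inv_mem hx, rfl⟩, by rw [gl_mul_ι, L.act_act_inv]⟩

theorem gl_mul_degOne_mem (g : G) {a : WAlg L} (ha : a ∈ degOne L) :
    gl L g * a ∈ LinearMap.range (ι L) := by
  obtain ⟨x, _, rfl⟩ := ha
  exact ⟨L.act g x, (gl_mul_ι L g x).symm⟩

/-- The span of the elements `g x ^ n` with `g : G` and `x` in the component of degree `1`. -/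
noncomputable def powSpan (n : ℕ) : Submodule k (WAlg L) :=
  Submodule.span k {b | ∃ g, ∃ a ∈ degOne L, gl L g * a ^ n = b}

theorem powSpan_one_le : powSpan L 1 ≤ LinearMap.range (ι L) := by
  refine Submodule.span_le.2 ?_
  rintro _ ⟨g, a, ha, rfl⟩
  rw [pow_one]
  exact gl_mul_degOne_mem L g ha

/-- The grouplikes are central and can be collected in front. What remains is multiplication of a
power by an element of degree one, which `mul_mem_span_pow` handles because the degree-one part is
closed under commutators. -/
theorem iSup_powSpan [CharZero k] : ⨆ n, powSpan L n = ⊤ := by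
  let S := Submodule.span k {b | ∃ m : ℕ, ∃ x ∈ degOne L, x ^ m = b}
  let N := ⨆ n, powSpan L n
  have hS : ∀ g, ∀ b ∈ S, gl L g * b ∈ N := by
    intro g b hb
    refine Submodule.span_le.2 ?_ hb |> fun h => (h : b ∈ N.comap (LinearMap.mulLeft k (gl L g)))
    rintro _ ⟨m, a, ha, rfl⟩
    exact le_iSup (powSpan L) m (Submodule.subset_span ⟨g, a, ha, rfl⟩)
  have hN : ∀ b ∈ N, ∀ a ∈ gens L, a * b ∈ N := by
    intro b hb a ha
    refine iSup_le (fun n => Submodule.span_le.2 ?_) hb |> fun h =>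
      (h : b ∈ N.comap (LinearMap.mulLeft k a))
    rintro _ ⟨g, y, hy, rfl⟩
    change a * (gl L g * y ^ n) ∈ N
    rcases ha with ⟨h, rfl⟩ | ⟨Q, x, hx, rfl⟩
    · rw [← mul_assoc, ← gl_mul]
      exact hS _ _ (Submodule.subset_span ⟨n, y, hy, rfl⟩)
    · obtain ⟨z, hz, hxz⟩ := ι_eq_gl_mul L hx
      rw [hxz, mul_assoc, ← mul_assoc z, ← gl_comm, mul_assoc, ← mul_assoc, ← gl_mul]
      exact hS _ _ (mul_mem_span_pow (degOne L) (fun _ hx _ hy => degOne_commutator L hx hy) hz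
        (Submodule.subset_span ⟨n, y, hy, rfl⟩))
  rw [eq_top_iff]
  intro a _
  have ha : a ∈ Algebra.adjoin k (gens L) := by rw [adjoin_gens]; trivial
  rw [← Subalgebra.mem_toSubmodule, Algebra.adjoin_eq_span] at ha
  refine Submodule.span_le.2 (fun b hb => ?_) ha
  induction hb using Submonoid.closure_induction_left with
  | one =>
    have h1 := hS 1 1 (Submodule.subset_span ⟨0, 0, Submodule.zero_mem _, pow_zero _⟩)
    rwa [gl_one, mul_one] at h1
  | mul_left x hx y _ ih => exact hN _ ih _ hx

end Span

section Primitive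

/-- Comparing the coefficients at `h ⊗ h` gives `z_h = 0` for `h ≠ Q` and `z_Q = 2 z_Q`. -/
theorem eq_zero_of_comul_monoidAlgebra {z : MonoidAlgebra k G} {Q : G}
    (hz : Coalgebra.comul (R := k) z =
      z ⊗ₜ MonoidAlgebra.of k G Q + MonoidAlgebra.of k G Q ⊗ₜ z) : z = 0 := by
  have key : ∀ h : G, LinearMap.mul' k k ∘ₗ TensorProduct.map
      (Finsupp.lapply h ∘ₗ (MonoidAlgebra.coeffLinearEquiv k).toLinearMap)
      (Finsupp.lapply h ∘ₗ (MonoidAlgebra.coeffLinearEquiv k).toLinearMap) ∘ₗ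
        Coalgebra.comul (R := k) (A := MonoidAlgebra k G) =
      Finsupp.lapply h ∘ₗ (MonoidAlgebra.coeffLinearEquiv k).toLinearMap := by
    intro h
    ext g
    by_cases hg : g = h
    · subst hg; simp
    · simp [Finsupp.single_eq_of_ne (Ne.symm hg)]
  refine MonoidAlgebra.ext (Finsupp.ext fun h => ?_)
  have h1 := DFunLike.congr_fun (key h) z
  simp only [LinearMap.comp_apply, hz, map_add, TensorProduct.map_tmul,
    LinearMap.mul'_apply] at h1
  by_cases hg : Q = h
  · subst hg
    simpa using h1
  · simpa [Finsupp.single_eq_of_ne (Ne.symm hg)] using h1.symm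

theorem retract_ι (x : L.carrier) : retract L (ι L x) = 0 := lift_ι ..

/-- The retraction to `kG` respects coproducts, and `kG` has no nonzero `Q`-primitives. -/
theorem retract_primitive {Q : G} {a : WAlg L}
    (ha : comul L a = a ⊗ₜ gl L Q + gl L Q ⊗ₜ a) : retract L a = 0 := by
  have h : (Algebra.TensorProduct.map (retract L) (retract L)).comp (comul L) =
      (Bialgebra.comulAlgHom k (MonoidAlgebra k G)).comp (retract L) :=
    algHom_ext_homog (fun g => by simp [comul_gl, retract_gl])
      (fun Q x hx => by simp [comul_ι L hx, retract_ι])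
  have h1 := DFunLike.congr_fun h a
  simp only [AlgHom.comp_apply, ha, map_add, Algebra.TensorProduct.map_tmul, retract_gl] at h1
  exact eq_zero_of_comul_monoidAlgebra h1.symm

/-- The endomorphism of `W(L)` which sends `g : G` to `g⁻¹` and kills `L`. -/
noncomputable def invRetract : WAlg L →ₐ[k] WAlg L :=
  (MonoidAlgebra.lift k (WAlg L) G
    (((ofGrp L : MonoidAlgebra k G →* WAlg L).comp (MonoidAlgebra.of k G)).comp
      (invMonoidHom : G →* G))).comp (retract L)

theorem invRetract_gl (g : G) : invRetract L (gl L g) = gl L g⁻¹ := by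
  rw [invRetract, AlgHom.comp_apply, retract_gl, MonoidAlgebra.lift_of]; rfl

theorem invRetract_comm (a b : WAlg L) :
    Commute (invRetract L a) (AlgHom.id k (WAlg L) b) := by
  rw [invRetract, AlgHom.comp_apply]
  induction retract L a using MonoidAlgebra.induction_linear with
  | zero => rw [map_zero]; exact Commute.zero_left _
  | add x y hx hy => rw [map_add]; exact hx.add_left hy
  | single g r => rw [MonoidAlgebra.lift_single]; exact Commute.smul_left (gl_comm L g⁻¹ b) r

/-- The algebra homomorphism `a ⊗ b ↦ invRetract a * b`. -/
noncomputable def invRetractMul : WAlg L ⊗[k] WAlg L →ₐ[k] WAlg L :=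
  Algebra.TensorProduct.lift (invRetract L) (AlgHom.id k (WAlg L)) (invRetract_comm L)

theorem invRetractMul_tmul (a b : WAlg L) :
    invRetractMul L (a ⊗ₜ b) = invRetract L a * b :=
  Algebra.TensorProduct.lift_tmul _ _ (invRetract_comm L) a b

/-- The endomorphism of `W(L)` which sends `G` to `1` and `x` of degree `Q` to `Q⁻¹ x`. -/
noncomputable def untwist : WAlg L →ₐ[k] WAlg L :=
  (invRetractMul L).comp (comul L)

theorem untwist_gl (g : G) : untwist L (gl L g) = 1 := by
  rw [untwist, AlgHom.comp_apply, comul_gl, invRetractMul_tmul, invRetract_gl,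
    ← gl_mul, inv_mul_cancel, gl_one]

/-- Of the two terms of the coproduct, the one with `a` on the left dies under the retraction. It
matters that `a` is any `Q`-primitive, not yet known to come from `L`. -/
theorem untwist_primitive {Q : G} {a : WAlg L} (ha : comul L a = a ⊗ₜ gl L Q + gl L Q ⊗ₜ a) :
    untwist L a = gl L Q⁻¹ * a := by
  rw [untwist, AlgHom.comp_apply, ha, map_add, invRetractMul_tmul,
    invRetractMul_tmul, invRetract_gl, invRetract, AlgHom.comp_apply,
    retract_primitive L ha, map_zero, zero_mul, zero_add]

/-- The linear endomorphism of `W(L)` which multiplies `g x ^ n` by `2 ^ n`, for `g : G` and `x` of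
degree `1`. -/
noncomputable def double : WAlg L →ₗ[k] WAlg L :=
  LinearMap.mul' k (WAlg L) ∘ₗ
    ((Algebra.TensorProduct.map (AlgHom.id k (WAlg L)) (untwist L)).comp (comul L)).toLinearMap

theorem double_powSpan (n : ℕ) {b : WAlg L} (hb : b ∈ powSpan L n) :
    double L b = (2 : k) ^ n • b := by
  have hl : ∀ (a : WAlg L) (t : WAlg L ⊗[k] WAlg L),
      LinearMap.mul' k (WAlg L) ((a ⊗ₜ[k] 1) * t) = a * LinearMap.mul' k (WAlg L) t := by
    intro a t
    induction t using TensorProduct.induction_on with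
    | zero => simp
    | tmul x y => simp [mul_assoc]
    | add x y hx hy => rw [mul_add, map_add, map_add, mul_add, hx, hy]
  induction hb using Submodule.span_induction with
  | mem b hb =>
    obtain ⟨g, a, ha, rfl⟩ := hb
    have hu : untwist L a = a := by
      rw [untwist_primitive L (Q := 1) (by rw [comul_degOne L ha, gl_one]), inv_one, gl_one,
        one_mul]
    simp only [double, LinearMap.comp_apply, AlgHom.toLinearMap_apply, AlgHom.comp_apply, map_mul,
      map_pow, comul_gl, comul_degOne L ha, map_add, Algebra.TensorProduct.map_tmul,
      AlgHom.id_apply, untwist_gl, hu, map_one]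
    rw [hl, mul'_primitive_pow, mul_smul_comm]
  | zero => simp
  | add a b _ _ ha hb => rw [map_add, ha, hb, smul_add]
  | smul c a _ ha => rw [map_smul, ha, smul_comm]

/-- In characteristic zero, the `Q`-primitive elements of `W(L)` are the elements of `L` of
degree `Q`. -/
theorem exists_ι_of_primitive [CharZero k] {Q : G} {a : WAlg L}
    (ha : a ∈ primitivesAt k (gl L Q)) : ∃ x ∈ L.deg Q, ι L x = a := by
  -- The two terms of the coproduct contribute `a * 1` and `Q * (Q⁻¹ * a)`.
  have hd : double L a = (2 : k) ^ 1 • a := by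
    have hc : comul L a = a ⊗ₜ gl L Q + gl L Q ⊗ₜ a := ha
    simp only [double, LinearMap.comp_apply, AlgHom.toLinearMap_apply, AlgHom.comp_apply, hc,
      map_add, Algebra.TensorProduct.map_tmul, AlgHom.id_apply, untwist_gl,
      untwist_primitive L hc, LinearMap.mul'_apply]
    rw [mul_one, ← mul_assoc, ← gl_mul, mul_inv_cancel, gl_one, one_mul, pow_one, two_smul]
  have hs : a ∈ ⨆ n, powSpan L n := by rw [iSup_powSpan]; trivial
  obtain ⟨c, hc, hca⟩ := (Submodule.mem_iSup_iff_exists_finsupp _ _).1 hs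
  let p : ℕ → Submodule k (WAlg L) := fun n => Module.End.eigenspace (double L) ((2 : k) ^ n)
  have hp : iSupIndep p :=
    iSupIndep_of_eigen (double L) p fun n x hx => Module.End.mem_eigenspace_iff.1 hx
  -- Being an eigenvector for `2 ^ 1`, `a` coincides with its component in `powSpan L 1`, which lies
  -- in the image of `L`.
  have h := eq_single_of_sum_eq hp (j := 1)
    (fun n => Module.End.mem_eigenspace_iff.2 (double_powSpan L n (hc n)))
    (Module.End.mem_eigenspace_iff.2 hd) hca
  have h1 : c 1 = a := by rw [h, Finsupp.single_eq_same]
  obtain ⟨x, rfl⟩ := powSpan_one_le L (h1 ▸ hc 1)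
  -- The degree of `x` is recovered from the independence of the spaces of primitives.
  exact ⟨x, L.mem_deg_of_map_mem (ι L) (ι_injective L) (rig L).iSupIndep_primitivesAt
    (fun g y hy => ι_mem_primitivesAt L hy) ha, rfl⟩

end Primitive

end WAlg

/-! ### A filtration of `W(L)` by degree in the primitives, and injectivity of bialgebra maps. -/

namespace WAlg

variable {k : Type u} [Field k] {G : Type v} [CommGroup G] (L : SuspLie.{u, v, w} k G)

section Coradical

/-- The span of the elements `g x ^ m` with `x` of degree `1` and `m ≤ n`, for fixed `g : G`. -/
noncomputable def cofilAt (n : ℕ) (g : G) : Submodule k (WAlg L) :=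
  Submodule.span k {b | ∃ m ≤ n, ∃ a ∈ degOne L, gl L g * a ^ m = b}

/-- The span of the elements `g x ^ m` with `g : G`, `x` of degree `1` and `m ≤ n`. -/
noncomputable def cofil (n : ℕ) : Submodule k (WAlg L) := ⨆ g, cofilAt L n g

/-- The span of the tensor products of two elements of `cofil L n`. -/
noncomputable def cofilTensor (n : ℕ) : Submodule k (WAlg L ⊗[k] WAlg L) :=
  Submodule.map₂ (TensorProduct.mk k (WAlg L) (WAlg L)) (cofil L n) (cofil L n)

variable {L}

theorem tmul_mem_cofilTensor {n : ℕ} {a b : WAlg L} (ha : a ∈ cofil L n) (hb : b ∈ cofil L n) :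
    a ⊗ₜ b ∈ cofilTensor L n :=
  Submodule.apply_mem_map₂ (TensorProduct.mk k (WAlg L) (WAlg L)) ha hb

theorem gl_mul_pow_mem_cofil {m n : ℕ} (h : m ≤ n) (g : G) {a : WAlg L} (ha : a ∈ degOne L) :
    gl L g * a ^ m ∈ cofil L n :=
  le_iSup (cofilAt L n) g (Submodule.subset_span ⟨m, h, a, ha, rfl⟩)

theorem gl_mem_cofil (n : ℕ) (g : G) : gl L g ∈ cofil L n := by
  simpa using gl_mul_pow_mem_cofil (Nat.zero_le n) g (degOne L).zero_mem

theorem comul_gl_mul_pow (g : G) {a : WAlg L} (ha : a ∈ degOne L) (m : ℕ) :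
    comul L (gl L g * a ^ m) = ∑ i ∈ Finset.range (m + 1),
      (m.choose i : k) • ((gl L g * a ^ i) ⊗ₜ[k] (gl L g * a ^ (m - i))) := by
  have hc : Commute (a ⊗ₜ[k] 1 : WAlg L ⊗[k] WAlg L) (1 ⊗ₜ[k] a) := by
    simp [Commute, SemiconjBy]
  rw [map_mul, map_pow, comul_gl, comul_degOne L ha, hc.add_pow, Finset.mul_sum]
  refine Finset.sum_congr rfl fun i _ => ?_
  rw [← nsmul_eq_mul', mul_smul_comm, Nat.cast_smul_eq_nsmul]
  simp

theorem comul_mem_cofilTensor {n : ℕ} {b : WAlg L} (hb : b ∈ cofil L n) :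
    comul L b ∈ cofilTensor L n := by
  refine iSup_le (fun g => Submodule.span_le.2 ?_) hb |> fun h =>
    (h : b ∈ (cofilTensor L n).comap (comul L).toLinearMap)
  rintro _ ⟨m, hm, a, ha, rfl⟩
  change comul L _ ∈ cofilTensor L n
  rw [comul_gl_mul_pow g ha]
  refine Submodule.sum_mem _ fun i hi => Submodule.smul_mem _ _ ?_
  have := Finset.mem_range.1 hi
  exact tmul_mem_cofilTensor (gl_mul_pow_mem_cofil (by omega) g ha)
    (gl_mul_pow_mem_cofil (by omega) g ha)

/-- The linear map which measures the failure of an element to be `g`-primitive. -/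
noncomputable def primDefect (g : G) : WAlg L →ₗ[k] WAlg L ⊗[k] WAlg L :=
  (comul L).toLinearMap - ((TensorProduct.mk k (WAlg L) (WAlg L)).flip (gl L g) +
    TensorProduct.mk k (WAlg L) (WAlg L) (gl L g))

theorem primDefect_apply (g : G) (b : WAlg L) :
    primDefect g b = comul L b - (b ⊗ₜ gl L g + gl L g ⊗ₜ b) := rfl

theorem primDefect_mem_of_mem {n : ℕ} (g : G) {b : WAlg L} (hb : b ∈ cofil L n) :
    primDefect g b ∈ cofilTensor L n := by
  rw [primDefect_apply]
  exact Submodule.sub_mem _ (comul_mem_cofilTensor hb) (Submodule.add_mem _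
    (tmul_mem_cofilTensor hb (gl_mem_cofil n g)) (tmul_mem_cofilTensor (gl_mem_cofil n g) hb))

/-- In the binomial expansion of the coproduct of `g a ^ (n + 1)`, the two extreme terms are exactly
the `g`-primitive part; in all others both tensor factors have degree at most `n`. -/
theorem primDefect_mem {n : ℕ} {g : G} {b : WAlg L} (hb : b ∈ cofilAt L (n + 1) g) :
    primDefect g b ∈ cofilTensor L n := by
  refine Submodule.span_le.2 ?_ hb |> fun h =>
    (h : b ∈ (cofilTensor L n).comap (primDefect g))
  rintro _ ⟨m, hm, a, ha, rfl⟩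
  change primDefect g _ ∈ cofilTensor L n
  obtain hm | rfl := Nat.lt_or_eq_of_le hm
  · exact primDefect_mem_of_mem g (gl_mul_pow_mem_cofil (Nat.lt_succ_iff.1 hm) g ha)
  · rw [primDefect_apply, comul_gl_mul_pow g ha, Finset.sum_range_succ, Finset.sum_range_succ']
    simp only [Nat.choose_self, Nat.choose_zero_right, Nat.cast_one, one_smul, Nat.sub_self,
      Nat.sub_zero, pow_zero, mul_one]
    rw [add_assoc, add_comm (gl L g ⊗ₜ[k] _), add_sub_cancel_right]
    refine Submodule.sum_mem _ fun i hi => Submodule.smul_mem _ _ ?_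
    have := Finset.mem_range.1 hi
    exact tmul_mem_cofilTensor (gl_mul_pow_mem_cofil (by omega) g ha)
      (gl_mul_pow_mem_cofil (by omega) g ha)

theorem exists_mem_cofil [CharZero k] (a : WAlg L) : ∃ n, a ∈ cofil L n := by
  have hmono : Monotone (cofil L) := fun m n h => iSup_mono fun g =>
    Submodule.span_mono fun _ ⟨i, hi, ha⟩ => ⟨i, hi.trans h, ha⟩
  have hle : ⨆ n, powSpan L n ≤ ⨆ n, cofil L n := by
    refine iSup_mono fun n => Submodule.span_le.2 ?_
    rintro _ ⟨g, a, ha, rfl⟩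
    exact gl_mul_pow_mem_cofil le_rfl g ha
  have ha : a ∈ ⨆ n, cofil L n := hle (by rw [iSup_powSpan]; trivial)
  exact (Submodule.mem_iSup_of_directed _ hmono.directed_le).1 ha

theorem cofil_zero_le : cofil L 0 ≤ Submodule.span k (Set.range (gl L)) := by
  refine iSup_le fun g => Submodule.span_le.2 ?_
  rintro _ ⟨m, hm, a, -, rfl⟩
  obtain rfl : m = 0 := by omega
  rw [pow_zero, mul_one]
  exact Submodule.subset_span ⟨g, rfl⟩

/-- Over a field every module is flat, so the tensor square of an injective map is injective. -/
theorem eq_zero_of_map_eq_zero {V V' : Type*} [AddCommGroup V] [Module k V] [AddCommGroup V']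
    [Module k V'] {f : V →ₗ[k] V'} {M : Submodule k V} (hf : ∀ a ∈ M, f a = 0 → a = 0)
    {t : V ⊗[k] V} (ht : t ∈ Submodule.map₂ (TensorProduct.mk k V V) M M)
    (h : TensorProduct.map f f t = 0) : t = 0 := by
  rw [← TensorProduct.range_mapIncl] at ht
  obtain ⟨s, rfl⟩ := ht
  have hinj : Function.Injective (f ∘ₗ M.subtype) :=
    (injective_iff_map_eq_zero _).2 fun a ha => Subtype.ext (hf a a.2 ha)
  have h1 : TensorProduct.map (f ∘ₗ M.subtype) (f ∘ₗ M.subtype) s = 0 := by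
    rw [TensorProduct.map_comp]; exact h
  have h2 := TensorProduct.map_injective_of_flat_flat _ _ hinj hinj (h1.trans (map_zero _).symm)
  rw [h2, map_zero]

theorem exists_dual {ι V : Type*} [AddCommGroup V] [Module k V] {v : ι → V}
    (hv : LinearIndependent k v) (i : ι) :
    ∃ f : V →ₗ[k] k, f (v i) = 1 ∧ ∀ j, j ≠ i → f (v j) = 0 := by
  obtain ⟨f, hf⟩ := LinearMap.exists_extend ((Finsupp.lapply i : (ι →₀ k) →ₗ[k] k) ∘ₗ
    (hv.repr : Submodule.span k (Set.range v) →ₗ[k] ι →₀ k))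
  have key : ∀ j, f (v j) = (Finsupp.single j 1 : ι →₀ k) i := by
    intro j
    have := DFunLike.congr_fun hf ⟨v j, Submodule.subset_span ⟨j, rfl⟩⟩
    simp only [LinearMap.comp_apply, Submodule.subtype_apply] at this
    rw [this, hv.repr_eq_single j _ rfl]
    rfl
  exact ⟨f, by rw [key, Finsupp.single_eq_same], fun j hj => by
    rw [key, Finsupp.single_eq_of_ne hj.symm]⟩

variable {A : Type*} [Ring A] [Bialgebra k A]

/-- A homomorphism of bialgebras out of `W(L)` is injective if it is so on `G` and on `L`. -/
theorem bialgHom_injective [CharZero k] (f : WAlg L →ₐc[k] A)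
    (hG : LinearIndependent k fun g => f (gl L g)) (hL : Function.Injective fun x => f (ι L x)) :
    Function.Injective f := by
  classical
  let F : WAlg L →ₗ[k] A := (f : WAlg L →ₗ[k] A)
  have hcomul : ∀ a, TensorProduct.map F F (comul L a) = Coalgebra.comul (R := k) (f a) :=
    fun a => CoalgHomClass.map_comp_comul_apply f a
  suffices h : ∀ n, ∀ a ∈ cofil L n, F a = 0 → a = 0 by
    refine (injective_iff_map_eq_zero _).2 fun a ha => ?_
    obtain ⟨n, hn⟩ := exists_mem_cofil a
    exact h n a hn ha
  intro n
  induction n with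
  | zero =>
    intro a ha h0
    exact Submodule.disjoint_def.1 (Submodule.range_ker_disjoint (f := F) (v := gl L) hG) a
      (cofil_zero_le ha) h0
  | succ n ih =>
    intro a ha h0
    obtain ⟨c, hc, rfl⟩ := (Submodule.mem_iSup_iff_exists_finsupp _ _).1 ha
    -- The summand `c g` need not be killed by `f` itself; the aim is to show that each one already
    -- lies one step lower in the filtration.
    suffices hn : ∀ g, c g ∈ cofil L n from
      ih _ (Submodule.sum_mem _ fun g _ => hn g) h0
    intro g
    obtain ⟨l, hlg, hl⟩ := exists_dual hG g
    -- Contracting the right factor with a functional dual to `f (gl L g)` isolates `f (c g)` from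
    -- the coproduct of the sum.
    let Φ : WAlg L ⊗[k] WAlg L →ₗ[k] A :=
      (TensorProduct.rid k A).toLinearMap ∘ₗ l.lTensor A ∘ₗ TensorProduct.map F F
    have hΦ : ∀ x y, Φ (x ⊗ₜ y) = l (f y) • f x := fun x y => by simp [Φ, F]
    have hΦT : ∀ t ∈ cofilTensor L n, Φ t ∈ (cofil L n).map F := by
      intro t ht
      refine Submodule.map₂_le.2 (fun x hx y _ => ?_) ht |> fun h =>
        (h : t ∈ ((cofil L n).map F).comap Φ)
      change Φ (x ⊗ₜ y) ∈ (cofil L n).map F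
      rw [hΦ]
      exact Submodule.smul_mem _ _ ⟨x, hx, rfl⟩
    have hsum : Φ (comul L (c.sum fun _ y => y)) =
        c.sum fun h y => Φ (primDefect h y) + (l (f (gl L h)) • f y + l (f y) • f (gl L h)) := by
      rw [map_finsuppSum, map_finsuppSum]
      refine Finsupp.sum_congr fun h _ => ?_
      rw [← hΦ, ← hΦ, ← map_add, ← map_add, primDefect_apply, sub_add_cancel]
    -- The contracted coproduct is zero since `f` kills the sum; every term of it other than `f (c
    -- g)` is the image of something in `cofil L n`.
    have hmem : f (c g) ∈ (cofil L n).map F := by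
      have hz : Φ (comul L (c.sum fun _ y => y)) = 0 := by
        simp only [Φ, LinearMap.comp_apply, hcomul]
        rw [show f (c.sum fun _ y => y) = 0 from h0]
        simp
      rw [hz, Finsupp.sum] at hsum
      by_cases hg : g ∈ c.support
      · rw [← Finset.add_sum_erase _ _ hg, hlg, one_smul] at hsum
        have h1 : f (c g) = -(Φ (primDefect g (c g)) + l (f (c g)) • f (gl L g) +
            ∑ h ∈ c.support.erase g, (Φ (primDefect h (c h)) +
              (l (f (gl L h)) • f (c h) + l (f (c h)) • f (gl L h)))) := by
          rw [eq_neg_iff_add_eq_zero, hsum]; abel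
        rw [h1]
        refine Submodule.neg_mem _ (Submodule.add_mem _ (Submodule.add_mem _
          (hΦT _ (primDefect_mem (hc g)))
          (Submodule.smul_mem _ _ ⟨_, gl_mem_cofil n g, rfl⟩)) (Submodule.sum_mem _ fun h hh => ?_))
        rw [hl h (Finset.ne_of_mem_erase hh), zero_smul, zero_add]
        exact Submodule.add_mem _ (hΦT _ (primDefect_mem (hc h)))
          (Submodule.smul_mem _ _ ⟨_, gl_mem_cofil n h, rfl⟩)
      · rw [Finsupp.notMem_support_iff.1 hg, map_zero]
        exact Submodule.zero_mem _
    obtain ⟨z, hz, hzc⟩ := hmem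
    have hb0 : F (c g - z) = 0 := by rw [map_sub, hzc]; exact sub_self _
    have hD : primDefect g (c g - z) ∈ cofilTensor L n := by
      rw [map_sub]
      exact Submodule.sub_mem _ (primDefect_mem (hc g)) (primDefect_mem_of_mem g hz)
    -- The defect lies in the tensor square of `cofil L n`, where `F ⊗ F` is injective by induction,
    -- and its image vanishes because `F (c g - z) = 0`. Hence `c g - z` is `g`-primitive.
    have hD0 : primDefect g (c g - z) = 0 := by
      refine eq_zero_of_map_eq_zero (f := F) ih hD ?_
      rw [primDefect_apply, map_sub, hcomul, map_add, TensorProduct.map_tmul,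
        TensorProduct.map_tmul, hb0, show f (c g - z) = 0 from hb0]
      simp
    rw [primDefect_apply, sub_eq_zero] at hD0
    obtain ⟨x, -, hx⟩ := exists_ι_of_primitive L (a := c g - z) hD0
    have hx0 : x = 0 := hL (by
      change f (ι L x) = f (ι L 0)
      rw [hx, map_zero, map_zero]; exact hb0)
    rw [hx0, map_zero, eq_comm, sub_eq_zero] at hx
    exact hx ▸ hz

end Coradical

end WAlg

/-! ### Bijective morphisms as isomorphisms. -/

section Iso

variable {k : Type u} [Field k] {G : Type v} [CommGroup G]

/-- A bijective homomorphism of suspensive Lie algebras which reflects degrees is an isomorphism. -/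
noncomputable def SuspLie.isoOfBijective {L M : SuspLie.{u, v, w} k G} (f : SuspLie.Hom L M)
    (hf : Function.Bijective f.toLieHom)
    (hdeg : ∀ g x, f.toLieHom x ∈ M.deg g → x ∈ L.deg g) : L ≅ M where
  hom := f
  inv :=
    { toLieHom := ((LieEquiv.ofBijective f.toLieHom hf).symm : M.carrier →ₗ⁅k⁆ L.carrier)
      map_deg := fun g y hy => hdeg g _ (by
        have h : f.toLieHom ((LieEquiv.ofBijective f.toLieHom hf).symm y) = y :=
          (LieEquiv.ofBijective f.toLieHom hf).apply_symm_apply y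
        exact h.symm ▸ hy)
      map_act := fun g y => hf.1 (by
        have h : ∀ y, f.toLieHom ((LieEquiv.ofBijective f.toLieHom hf).symm y) = y :=
          (LieEquiv.ofBijective f.toLieHom hf).apply_symm_apply
        exact (h _).trans ((congrArg (M.act g) (h y)).symm.trans (f.map_act g _).symm)) }
  hom_inv_id := SuspLie.Hom.ext (LieHom.ext fun x =>
    (LieEquiv.ofBijective f.toLieHom hf).symm_apply_apply x)
  inv_hom_id := SuspLie.Hom.ext (LieHom.ext fun x =>
    (LieEquiv.ofBijective f.toLieHom hf).apply_symm_apply x)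

/-- A bijective homomorphism of rigid bialgebras is an isomorphism. -/
noncomputable def RigBialg.isoOfBijective {A B : RigBialg.{u, v, w} k G} (f : RigBialg.Hom A B)
    (hf : Function.Bijective f.toBialgHom) : A ≅ B where
  hom := f
  inv :=
    { toBialgHom := ((BialgEquiv.ofBijective f.toBialgHom hf).symm : B.carrier →ₐc[k] A.carrier)
      comp_η := by
        refine BialgHom.ext fun x => hf.1 ?_
        exact ((BialgEquiv.ofBijective f.toBialgHom hf).apply_symm_apply _).trans
          (DFunLike.congr_fun f.comp_η x).symm }
  hom_inv_id := RigBialg.Hom.ext (BialgHom.ext fun x =>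
    (BialgEquiv.ofBijective f.toBialgHom hf).symm_apply_apply x)
  inv_hom_id := RigBialg.Hom.ext (BialgHom.ext fun x =>
    (BialgEquiv.ofBijective f.toBialgHom hf).apply_symm_apply x)

end Iso

/-! ### The unit isomorphism. -/

section Unit

attribute [local instance 100] LieRing.ofAssociativeRing

variable {k : Type u} [Field k] {G : Type v} [CommGroup G] (L : SuspLie.{u, v, max u v w} k G)

theorem ι_mem_genPrimitives (x : L.carrier) : WAlg.ι L x ∈ genPrimitives k (WAlg L) :=
  L.homog_induction (p := fun x => WAlg.ι L x ∈ genPrimitives k (WAlg L))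
    (fun Q _ hx => (WAlg.rig L).primitivesAt_le Q (WAlg.ι_mem_primitivesAt L hx))
    (fun x y hx hy => by rw [map_add]; exact Submodule.add_mem _ hx hy) x

/-- The unit `L → GP_*(W(L))`. -/
noncomputable def unitHom : SuspLie.Hom L (gp (WAlg.rig L)) where
  toLieHom :=
    { toFun := fun x => ⟨WAlg.ι L x, ι_mem_genPrimitives L x⟩
      map_add' := fun x y => Subtype.ext (map_add (WAlg.ι L) x y)
      map_smul' := fun c x => Subtype.ext (map_smul (WAlg.ι L) c x)
      map_lie' := fun {x y} => Subtype.ext (WAlg.ι_lie L x y) }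
  map_deg _ _ hx := WAlg.ι_mem_primitivesAt L hx
  map_act g x := Subtype.ext (WAlg.gl_mul_ι L g x).symm

theorem unitHom_bijective [CharZero k] : Function.Bijective (unitHom L).toLieHom := by
  refine ⟨fun x y h => WAlg.ι_injective L (congrArg Subtype.val h), fun ⟨a, ha⟩ => ?_⟩
  have h : genPrimitives k (WAlg L) ≤ LinearMap.range (WAlg.ι L) := by
    refine ((WAlg.rig L).genPrimitives_eq).le.trans (iSup_le fun g a ha => ?_)
    obtain ⟨x, -, rfl⟩ := WAlg.exists_ι_of_primitive L ha
    exact ⟨x, rfl⟩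
  obtain ⟨x, hx⟩ := h ha
  exact ⟨x, Subtype.ext hx⟩

/-- The unit isomorphism `L ≅ GP_*(W(L))`. -/
noncomputable def unitIso [CharZero k] : L ≅ gp (WAlg.rig L) :=
  SuspLie.isoOfBijective (unitHom L) (unitHom_bijective L) fun g x hx => by
    obtain ⟨y, hy, hyx⟩ := WAlg.exists_ι_of_primitive L (Q := g) (a := WAlg.ι L x) hx
    exact WAlg.ι_injective L hyx ▸ hy

end Unit

/-! ### The counit isomorphism. -/

section Counit

variable {k : Type u} [Field k] {G : Type v} [CommGroup G] (A : RigBialg.{u, v, max u v w} k G)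

/-- The counit `W(GP_*(A)) → A` as a homomorphism of algebras. -/
noncomputable def counitAlgHom : WAlg (gp A) →ₐ[k] A.carrier :=
  WAlg.lift (L := gp A) ⟨⟨A.gl, A.gl_one⟩, A.gl_mul⟩ (genPrimitives k A.carrier).subtype
    (fun g _ => A.gl_comm g _) (fun _ _ => rfl) (fun _ _ => rfl)

theorem counitAlgHom_gl (g : G) : counitAlgHom A (WAlg.gl (gp A) g) = A.gl g :=
  WAlg.lift_gl ..

theorem counitAlgHom_ι (x : (gp A).carrier) :
    counitAlgHom A (WAlg.ι (gp A) x) = (x : gpLie A).1 :=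
  WAlg.lift_ι ..

/-- Applying the counit to both factors of the coproduct gives `ε a = ε a + ε a`. -/
theorem counit_primitive {g : G} {a : A.carrier} (ha : a ∈ primitivesAt k (A.gl g)) :
    Coalgebra.counit (R := k) a = 0 := by
  have h := congrArg (fun t => (TensorProduct.lid k k)
    (TensorProduct.map Coalgebra.counit Coalgebra.counit t)) (mem_primitivesAt.1 ha)
  have h2 : ∀ a : A.carrier, (TensorProduct.lid k k) (TensorProduct.map Coalgebra.counit
      Coalgebra.counit (Coalgebra.comul (R := k) a)) = Coalgebra.counit a := fun a => by
    rw [← LinearMap.lTensor_comp_rTensor, LinearMap.comp_apply, Coalgebra.rTensor_counit_comul]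
    simp
  simp only [h2, map_add, TensorProduct.map_tmul, (A.isGroupLikeElem_gl g).counit_eq_one,
    TensorProduct.lid_tmul, smul_eq_mul, mul_one, one_mul] at h
  simpa using h

/-- The counit `W(GP_*(A)) → A` as a homomorphism of bialgebras. -/
noncomputable def counitBialgHom : WAlg (gp A) →ₐc[k] A.carrier :=
  BialgHom.ofAlgHom (counitAlgHom A)
    (WAlg.algHom_ext_homog
      (fun g => by
        change Coalgebra.counit (R := k) (counitAlgHom A (WAlg.gl (gp A) g)) =
          WAlg.counit (gp A) (WAlg.gl (gp A) g)
        rw [counitAlgHom_gl, WAlg.counit_gl, (A.isGroupLikeElem_gl g).counit_eq_one])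
      (fun Q x hx => by
        change Coalgebra.counit (R := k) (counitAlgHom A (WAlg.ι (gp A) x)) =
          WAlg.counit (gp A) (WAlg.ι (gp A) x)
        rw [counitAlgHom_ι, WAlg.counit_ι]
        exact counit_primitive A hx))
    (WAlg.algHom_ext_homog
      (fun g => by
        change Algebra.TensorProduct.map (counitAlgHom A) (counitAlgHom A)
          (WAlg.comul (gp A) (WAlg.gl (gp A) g)) =
          Coalgebra.comul (R := k) (counitAlgHom A (WAlg.gl (gp A) g))
        rw [WAlg.comul_gl, Algebra.TensorProduct.map_tmul, counitAlgHom_gl,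
          (A.isGroupLikeElem_gl g).comul_eq_tmul_self])
      (fun Q x hx => by
        change Algebra.TensorProduct.map (counitAlgHom A) (counitAlgHom A)
          (WAlg.comul (gp A) (WAlg.ι (gp A) x)) =
          Coalgebra.comul (R := k) (counitAlgHom A (WAlg.ι (gp A) x))
        rw [WAlg.comul_ι (gp A) hx, map_add, Algebra.TensorProduct.map_tmul,
          Algebra.TensorProduct.map_tmul, counitAlgHom_gl, counitAlgHom_ι]
        exact (mem_primitivesAt.1 hx).symm))

/-- The counit `W(GP_*(A)) → A`. -/
noncomputable def counitHom : RigBialg.Hom (WAlg.rig (gp A)) A where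
  toBialgHom := counitBialgHom A
  comp_η := BialgHom.coe_toAlgHom_injective
    (MonoidAlgebra.algHom_ext (fun g => counitAlgHom_gl A g) (Subsingleton.elim _ _))

/-- The only place where generation by grouplikes and generalized primitives enters. -/
theorem counitAlgHom_surjective (hA : IsGenPrimGenerated k A.carrier) :
    Function.Surjective (counitAlgHom A) := by
  rw [← AlgHom.range_eq_top, eq_top_iff, ← hA, Algebra.adjoin_le_iff]
  rintro a (ha | ha)
  · obtain ⟨g, rfl⟩ := A.exists_gl ha
    exact ⟨_, counitAlgHom_gl A g⟩
  · exact ⟨_, counitAlgHom_ι A ⟨a, ha⟩⟩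

theorem counitHom_bijective [CharZero k] (hA : IsGenPrimGenerated k A.carrier) :
    Function.Bijective (counitHom A).toBialgHom := by
  refine ⟨WAlg.bialgHom_injective (counitBialgHom A) ?_ fun x y h => ?_,
    counitAlgHom_surjective A hA⟩
  · convert A.linearIndependent_gl using 1
    funext g
    exact counitAlgHom_gl A g
  · exact Subtype.ext ((counitAlgHom_ι A x).symm.trans (h.trans (counitAlgHom_ι A y)))

end Counit

end GRigid

/-! ### The equivalence of categories. -/

theorem mainTheorem8 (k : Type u) [Field k] [CharZero k] (G : Type v) [CommGroup G] :
    ∃ e : GRigid.SuspLie.{u, v, max u v w} k G ≌ GRigid.GPGRigBialg.{u, v, max u v w} k G,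
      e.functor = GRigid.W.{u, v, w} k G ∧ e.inverse = GRigid.GP.{u, v, max u v w} k G := by
  refine ⟨CategoryTheory.Equivalence.mk (GRigid.W.{u, v, w} k G) (GRigid.GP.{u, v, max u v w} k G)
    (NatIso.ofComponents (fun L => GRigid.unitIso.{u, v, w} L) ?_)
    (NatIso.ofComponents (fun A => ObjectProperty.isoMk _ (GRigid.RigBialg.isoOfBijective
      (GRigid.counitHom.{u, v, w} A.obj) (GRigid.counitHom_bijective A.obj A.property))) ?_),
    rfl, rfl⟩
  · intro L M f
    refine GRigid.SuspLie.Hom.ext (LieHom.ext fun x => Subtype.ext ?_)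
    exact (GRigid.WAlg.map_ι L f x).symm
  · intro A B f
    apply ObjectProperty.hom_ext
    apply GRigid.RigBialg.Hom.ext
    apply BialgHom.coe_toAlgHom_injective
    -- Naturality of the counit is checked on the generators of `W(GP_*(A))`: the elements of `G`
    -- and the generalized primitives.
    refine GRigid.WAlg.algHom_ext (fun g => ?_) (fun x => ?_)
    · refine (congrArg (GRigid.counitAlgHom B.obj)
        (GRigid.WAlg.map_gl (GRigid.gp A.obj) (GRigid.gpMap f.hom) g)).trans ?_
      refine (GRigid.counitAlgHom_gl B.obj g).trans ?_
      exact ((congrArg f.hom.toBialgHom (GRigid.counitAlgHom_gl A.obj g)).trans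
        (f.hom.map_gl g)).symm
    · refine (congrArg (GRigid.counitAlgHom B.obj)
        (GRigid.WAlg.map_ι (GRigid.gp A.obj) (GRigid.gpMap f.hom) x)).trans ?_
      refine (GRigid.counitAlgHom_ι B.obj _).trans ?_
      exact (congrArg f.hom.toBialgHom (GRigid.counitAlgHom_ι A.obj x)).symm
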